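/- Fix the embedding $\overline{\mathbb Q}\subset\mathbb C$. A $G$-function is a power series $f(z)=\sum_{n\ge 0}a_nz^n$ with $a_n\in\overline{\mathbb Q}$ for which there is $C>0$ such that (i) for every $n$, all conjugates of $a_n$ have modulus at most $C^{n+1}$; (ii) there are nonzero integers $d_n$ with $|d_n|\le C^{n+1}$ such that $d_na_m$ is an algebraic integer for all $m\le n$; (iii) $f$ satisfies a nontrivial homogeneous linear differential equation with coefficients in $\overline{\mathbb Q}(z)$. Let $\mathbf G\subset\mathbb C$ be the set of all values at algebraic points of analytic continuations of $G$-functions (along paths that start at $0$ and end at the point considered). Let $\gamma$ be Euler's constant. Then $\mathbf G$ is a subring of $\mathbb C$. Let $\mathbf S\subset\mathbb C$ be the $\mathbf G$-module generated by all the numbers $\Gamma^{(n)}(s)$, for integers $n\ge 0$ and $s\in\mathbb Q\setminus\mathbb Z_{\le 0}$. Then $\mathbf S$ is equal to the $\mathbf G[\gamma]$-module generated by all the numbers $\Gamma(s)$, for $s\in\mathbb Q\setminus\mathbb Z_{\le 0}$. Moreover, $\mathbf S$ is a subring of $\mathbb C$. -/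

import Mathlib

open Filter Topology

namespace GSeries

/-- The field of algebraic numbers, as a subfield of `ℂ`. -/
noncomputable abbrev Qbar : IntermediateField ℚ ℂ := algebraicClosure ℚ ℂ

/-- A formal power series with algebraic coefficients is holonomic if it satisfies a (nontrivial)
homogeneous linear differential equation with coefficients in `Qbar(z)`. Denominators are cleared,
so that the coefficients `p 0, …, p r` are polynomials, and the leading one is nonzero. -/
def IsHolonomic (f : PowerSeries Qbar) : Prop :=
  ∃ (r : ℕ) (p : ℕ → Polynomial Qbar), p r ≠ 0 ∧
    ∑ i ∈ Finset.range (r + 1),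
      (p i : PowerSeries Qbar) * (PowerSeries.derivative Qbar)^[i] f = 0

/-- `G`-functions `∑ a_n z^n`. The conjugates of an algebraic number `a` are the numbers `σ a`,
for `σ` a field embedding of `Qbar` into `ℂ`. -/
def IsGFunction (f : PowerSeries Qbar) : Prop :=
  (∃ C : ℝ, 0 < C ∧
    (∀ (n : ℕ) (σ : Qbar →+* ℂ), ‖σ (PowerSeries.coeff n f)‖ ≤ C ^ (n + 1)) ∧
    ∃ d : ℕ → ℤ, ∀ n : ℕ, d n ≠ 0 ∧ |(d n : ℝ)| ≤ C ^ (n + 1) ∧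
      ∀ m ≤ n, IsIntegral ℤ ((d n : Qbar) * PowerSeries.coeff m f)) ∧
  IsHolonomic f

/-- `F` is an analytic continuation along the path `γ`, which starts at `0`, of the germ at `0`
defined by the power series `f`: each `F t` is a holomorphic germ at `γ t`, the germ at time `u`
is induced by the one at time `t` when `u` is close to `t`, and `F 0` is the sum of `f`. -/
structure IsContinuationAlong (f : PowerSeries Qbar) {α : ℂ} (γ : Path (0 : ℂ) α)
    (F : unitInterval → ℂ → ℂ) : Prop where
  start : ∀ᶠ z in 𝓝 (0 : ℂ), HasSum (fun n : ℕ => ((PowerSeries.coeff n f : Qbar) : ℂ) * z ^ n)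
    (F 0 z)
  analytic : ∀ t, AnalyticAt ℂ (F t) (γ t)
  compat : ∀ t, ∀ᶠ u in 𝓝 t, F u =ᶠ[𝓝 (γ u)] F t

/-- The set of all values at algebraic points of analytic continuations of `G`-functions. -/
def gValues : Set ℂ :=
  {v | ∃ f : PowerSeries Qbar, IsGFunction f ∧
    ∃ α : ℂ, IsAlgebraic ℚ α ∧ ∃ (γ : Path (0 : ℂ) α) (F : unitInterval → ℂ → ℂ),
      IsContinuationAlong f γ F ∧ F 1 α = v}

/-- The rational numbers that are not non-positive integers. -/
def admissible : Set ℚ := {s | ∀ m : ℕ, s ≠ -(m : ℚ)}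

/-- The `G`-module generated by all the numbers `Γ^{(n)}(s)`. -/
noncomputable def gammaDerivModule (G : Subring ℂ) : Submodule G ℂ :=
  Submodule.span G {z : ℂ | ∃ n : ℕ, ∃ s ∈ admissible, z = iteratedDeriv n Complex.Gamma (s : ℂ)}

/-- The ring `G[γ]`, where `γ` is Euler's constant. -/
noncomputable abbrev adjoinEuler (G : Subring ℂ) : Subalgebra G ℂ :=
  Algebra.adjoin G {(Real.eulerMascheroniConstant : ℂ)}

/-- The `G[γ]`-module generated by all the numbers `Γ(s)`. -/
noncomputable def gammaModule (G : Subring ℂ) : Submodule (adjoinEuler G) ℂ :=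
  Submodule.span (adjoinEuler G) {z : ℂ | ∃ s ∈ admissible, z = Complex.Gamma (s : ℂ)}

end GSeries

/-! Three mechanisms carry the proof. First, G-functions are stable under sums, products and
substitution of a polynomial φ over `Qbar` with φ(0) = 0. A path from 0 to an algebraic α can be
replaced by a nearby polynomial path φ with the same ends, and f ∘ φ, continued along the segment
[0, 1], ends at the value of f at α. All values are thus reached along one common path, so sums and
products of values come from sums and products of functions (`mem_gValues_iff_unitPath`, `gRing`).

Second, let h be the sum of a G-function on the unit disc and a > 0 rational. Dividing the n-th
coefficient by n + a gives a G-function with sum H such that zH' + aH = h, and integration by parts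
shows, by induction on j, that the integral of x^(a-1) log(x)^j h(x) over (0, 1/2) lies in G
(`IsGSum.integral_mem_gRing`). Cutting (0, 1) at 1/2 and reflecting the right half puts in G the
beta values B(a, b), as well as all derivatives at positive rationals of M(s) = ∫₀¹ t^(s-1) log(1-t)
dt.

Third, differentiating Γ(b)Γ(s) = Γ(b+s)B(b,s) at b = 1 gives Γ'(s+1)/Γ(s+1) = -γ - s M(s). Hence at
a rational s > 1 the digamma function is -γ plus an element of G, and its higher derivatives lie in
G. Leibniz' rule, then Γ(s+1) = sΓ(s) to reach the other s, yields Γ^(n)(s) = Γ(s)((-γ)^n + lower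
powers of γ over G) (`gammaDerivExpansion`). This triangular system with diagonal ±1 can be
inverted, so both modules agree; the ring property is Γ(s)Γ(t) = B(s,t)Γ(s+t). -/

namespace GSeries

open scoped Polynomial PowerSeries Pointwise

/-! ### D-finite power series and their closure properties -/

section DFinite

variable {k : Type*} [Field k]

/-- A power series is D-finite if it lies in a finitely generated `k[X]`-submodule of `k⟦X⟧` which
is stable under differentiation up to a common denominator. -/
def IsDFinite (f : k⟦X⟧) : Prop :=
  ∃ (S : Set k⟦X⟧) (q : k[X]), S.Finite ∧ q ≠ 0 ∧ f ∈ Submodule.span k[X] S ∧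
    ∀ g ∈ Submodule.span k[X] S, q • PowerSeries.derivative k g ∈ Submodule.span k[X] S

theorem polynomial_smul_def (p : k[X]) (f : k⟦X⟧) : p • f = (p : k⟦X⟧) * f := by
  rw [Algebra.smul_def]; rfl

theorem derivative_polynomial_smul (p : k[X]) (f : k⟦X⟧) :
    PowerSeries.derivative k (p • f) =
      p • PowerSeries.derivative k f + (Polynomial.derivative p) • f := by
  simp only [polynomial_smul_def, Derivation.leibniz, PowerSeries.derivative_coe, smul_eq_mul]
  ring

/-- Checking generators suffices because (a x)' = a x' + a' x, and the extra term a' x already lies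
in T. -/
theorem smul_derivative_mem_span {S : Set k⟦X⟧} {T : Submodule k[X] k⟦X⟧} {q : k[X]}
    (hST : S ⊆ T) (h : ∀ g ∈ S, q • PowerSeries.derivative k g ∈ T) :
    ∀ g ∈ Submodule.span k[X] S, q • PowerSeries.derivative k g ∈ T := by
  intro g hg
  induction hg using Submodule.span_induction with
  | mem x hx => exact h x hx
  | zero => simp
  | add x y _ _ hx hy => rw [map_add, smul_add]; exact T.add_mem hx hy
  | smul a x hx' hx =>
    rw [derivative_polynomial_smul, smul_add, smul_comm q a, smul_smul q]
    exact T.add_mem (T.smul_mem _ hx) (T.smul_mem _ (Submodule.span_le.2 hST hx'))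

theorem isDFinite_polynomial (p : k[X]) : IsDFinite (p : k⟦X⟧) := by
  refine ⟨{1}, 1, Set.finite_singleton _, one_ne_zero, ?_, ?_⟩
  · rw [Submodule.mem_span_singleton]
    exact ⟨p, by rw [polynomial_smul_def, mul_one]⟩
  · refine smul_derivative_mem_span Submodule.subset_span ?_
    rintro g rfl
    simp

theorem IsDFinite.add {f g : k⟦X⟧} (hf : IsDFinite f) (hg : IsDFinite g) : IsDFinite (f + g) := by
  obtain ⟨S, q, hS, hq, hfS, hqS⟩ := hf
  obtain ⟨T, r, hT, hr, hgT, hrT⟩ := hg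
  have h1 : Submodule.span k[X] S ≤ Submodule.span k[X] (S ∪ T) :=
    Submodule.span_mono Set.subset_union_left
  have h2 : Submodule.span k[X] T ≤ Submodule.span k[X] (S ∪ T) :=
    Submodule.span_mono Set.subset_union_right
  refine ⟨S ∪ T, q * r, hS.union hT, mul_ne_zero hq hr, Submodule.add_mem _ (h1 hfS) (h2 hgT),
    smul_derivative_mem_span Submodule.subset_span ?_⟩
  rintro g (hg | hg)
  · rw [mul_comm, mul_smul]
    exact Submodule.smul_mem _ _ (h1 (hqS _ (Submodule.subset_span hg)))
  · rw [mul_smul]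
    exact Submodule.smul_mem _ _ (h2 (hrT _ (Submodule.subset_span hg)))

/-- By Leibniz' rule, the span of the pairwise products of generators is stable under q r d/dX. -/
theorem IsDFinite.mul {f g : k⟦X⟧} (hf : IsDFinite f) (hg : IsDFinite g) : IsDFinite (f * g) := by
  obtain ⟨S, q, hS, hq, hfS, hqS⟩ := hf
  obtain ⟨T, r, hT, hr, hgT, hrT⟩ := hg
  have key : ∀ x ∈ Submodule.span k[X] S, ∀ y ∈ Submodule.span k[X] T,
      x * y ∈ Submodule.span k[X] (S * T) := fun x hx y hy => by
    rw [← Submodule.span_mul_span]; exact Submodule.mul_mem_mul hx hy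
  refine ⟨S * T, q * r, hS.mul hT, mul_ne_zero hq hr, key _ hfS _ hgT,
    smul_derivative_mem_span Submodule.subset_span ?_⟩
  rintro _ ⟨x, hx, y, hy, rfl⟩
  have hx' := Submodule.subset_span (R := k[X]) hx
  have hy' := Submodule.subset_span (R := k[X]) hy
  have : (q * r) • PowerSeries.derivative k (x * y) =
      q • (x * (r • PowerSeries.derivative k y)) +
      r • ((q • PowerSeries.derivative k x) * y) := by
    simp only [polynomial_smul_def, Derivation.leibniz, smul_eq_mul, Polynomial.coe_mul]
    ring
  change (q * r) • PowerSeries.derivative k (x * y) ∈ _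
  rw [this]
  exact Submodule.add_mem _ (Submodule.smul_mem _ _ (key _ hx' _ (hrT _ hy')))
    (Submodule.smul_mem _ _ (key _ (hqS _ hx') _ hy'))

theorem polynomial_subst_coe (p φ : k[X]) (hφ : PowerSeries.HasSubst (φ : k⟦X⟧)) :
    (p : k⟦X⟧).subst (φ : k⟦X⟧) = (p.comp φ : k[X]) := by
  rw [PowerSeries.subst_coe hφ]
  induction p using Polynomial.induction_on' with
  | add p q hp hq => rw [map_add, hp, hq, Polynomial.add_comp, Polynomial.coe_add]
  | monomial n a =>
    rw [Polynomial.aeval_monomial, Polynomial.monomial_comp, Polynomial.coe_mul,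
      Polynomial.coe_pow, Polynomial.coe_C]
    rfl

/-- By the chain rule, the span of the substituted generators is stable with denominator q ∘ φ. -/
theorem IsDFinite.subst {f : k⟦X⟧} (hf : IsDFinite f) {φ : k[X]} (hφ : φ.coeff 0 = 0) :
    IsDFinite (f.subst (φ : k⟦X⟧)) := by
  have hs : PowerSeries.HasSubst (φ : k⟦X⟧) :=
    PowerSeries.HasSubst.of_constantCoeff_zero' (by simpa using hφ)
  obtain ⟨S, q, hS, hq, hfS, hqS⟩ := hf
  -- For φ = 0 the denominator q ∘ φ = q(0) may vanish, but the series is then a constant.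
  by_cases h0 : φ = 0
  · subst h0
    have := isDFinite_polynomial (Polynomial.C (PowerSeries.constantCoeff f))
    rw [Polynomial.coe_zero]
    have h2 := PowerSeries.subst_zero_eq_C_constantCoeff (f := f) (S := k) (τ := Unit)
    convert! this using 1
    rw [Polynomial.coe_C]
    exact h2
  have hsub : ∀ (p : k[X]) (g : k⟦X⟧), (p • g).subst (φ : k⟦X⟧) =
      p.comp φ • g.subst (φ : k⟦X⟧) := fun p g => by
    rw [polynomial_smul_def, PowerSeries.subst_mul hs, polynomial_subst_coe _ _ hs,
      polynomial_smul_def]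
  have key : ∀ g ∈ Submodule.span k[X] S, (g.subst (φ : k⟦X⟧) : k⟦X⟧) ∈
      Submodule.span k[X] ((fun g : k⟦X⟧ => (g.subst (φ : k⟦X⟧) : k⟦X⟧)) '' S) := by
    intro g hg
    induction hg using Submodule.span_induction with
    | mem x hx => exact Submodule.subset_span ⟨x, hx, rfl⟩
    | zero =>
      rw [← PowerSeries.coe_substAlgHom hs, map_zero]
      exact Submodule.zero_mem _
    | add x y _ _ hx hy =>
      rw [PowerSeries.subst_add hs]
      exact Submodule.add_mem _ hx hy
    | smul a x _ hx => rw [hsub]; exact Submodule.smul_mem _ _ hx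
  refine ⟨_, q.comp φ, hS.image _, ?_, key _ hfS,
    smul_derivative_mem_span Submodule.subset_span ?_⟩
  · intro h
    rcases Polynomial.comp_eq_zero_iff.1 h with h | ⟨-, h⟩
    · exact hq h
    · rw [hφ, map_zero] at h
      exact h0 h
  · rintro _ ⟨x, hx, rfl⟩
    have h := key _ (hqS _ (Submodule.subset_span hx))
    rw [hsub] at h
    have h2 := Submodule.smul_mem _ (Polynomial.derivative φ) h
    change q.comp φ • PowerSeries.derivative k (x.subst (φ : k⟦X⟧)) ∈ _
    rw [PowerSeries.derivative_subst hs, PowerSeries.derivative_coe]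
    convert h2 using 1
    simp only [polynomial_smul_def]
    ring

/-- If `q g' + r g` is D-finite with `q ≠ 0`, then so is `g`. -/
theorem IsDFinite.of_first_order {g : k⟦X⟧} {q r : k[X]} (hq : q ≠ 0)
    (hf : IsDFinite (q • PowerSeries.derivative k g + r • g)) : IsDFinite g := by
  obtain ⟨S, s, hS, hs, hfS, hsS⟩ := hf
  have h1 : Submodule.span k[X] S ≤ Submodule.span k[X] (insert g S) :=
    Submodule.span_mono (Set.subset_insert _ _)
  have hg : g ∈ Submodule.span k[X] (insert g S) := Submodule.subset_span (Set.mem_insert _ _)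
  refine ⟨insert g S, s * q, hS.insert _, mul_ne_zero hs hq, hg,
    smul_derivative_mem_span Submodule.subset_span ?_⟩
  rintro x (rfl | hx)
  · rw [mul_smul]
    refine Submodule.smul_mem _ _ ?_
    have h3 := Submodule.sub_mem _ (h1 hfS) (Submodule.smul_mem _ r hg)
    rwa [add_sub_cancel_right] at h3
  · rw [mul_comm, mul_smul]
    exact Submodule.smul_mem _ _ (h1 (hsS _ (Submodule.subset_span hx)))

/-- All q^i f^(i) lie in one finitely generated module over the Noetherian ring k[X]. The increasing
spans of the first n of them stabilize, so some q^n f^(n) is a combination of its predecessors; its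
coefficient q^n is the nonzero leading one. -/
theorem IsDFinite.exists_relation {f : k⟦X⟧} (hf : IsDFinite f) :
    ∃ (r : ℕ) (p : ℕ → k[X]), p r ≠ 0 ∧ ∑ i ∈ Finset.range (r + 1),
      (p i : k⟦X⟧) * (PowerSeries.derivative k)^[i] f = 0 := by
  obtain ⟨S, q, hS, hq, hfS, hqS⟩ := hf
  set M := Submodule.span k[X] S with hM
  have hmem : ∀ i, q ^ i • (PowerSeries.derivative k)^[i] f ∈ M := by
    intro i
    induction i with
    | zero => simpa using hfS
    | succ i ih =>
      have h := hqS _ ih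
      rw [derivative_polynomial_smul, smul_add, smul_smul, ← pow_succ',
        ← Function.iterate_succ_apply' (PowerSeries.derivative k)] at h
      have h2 : q • (Polynomial.derivative (q ^ i)) • (PowerSeries.derivative k)^[i] f ∈ M := by
        rw [Polynomial.derivative_pow, smul_smul]
        cases i with
        | zero => simp
        | succ i =>
          have : q * (Polynomial.C ((i + 1 : ℕ) : k) * q ^ (i + 1 - 1) * Polynomial.derivative q) =
            (Polynomial.C ((i + 1 : ℕ) : k) * Polynomial.derivative q) * q ^ (i + 1) := by
              simp only [Nat.add_sub_cancel]; ring
          rw [this, mul_smul]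
          exact M.smul_mem _ ih
      have h3 := M.sub_mem h h2
      rwa [add_sub_cancel_right] at h3
  have hfin : Module.Finite k[X] M := Module.Finite.iff_fg.2 (Submodule.fg_span hS)
  let v : ℕ → M := fun i => ⟨_, hmem i⟩
  let N : ℕ →o Submodule k[X] M :=
    ⟨fun n => Submodule.span k[X] (v '' (Finset.range n : Set ℕ)), fun a b hab =>
      Submodule.span_mono (Set.image_mono (by
        intro x; simp only [Finset.coe_range, Set.mem_Iio]; omega))⟩
  obtain ⟨n, hn⟩ := monotone_stabilizes_iff_noetherian.2
    (inferInstance : IsNoetherian k[X] M) N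
  have hv : v n ∈ N n := by
    rw [hn (n + 1) (Nat.le_succ n)]
    exact Submodule.subset_span ⟨n, by simp, rfl⟩
  obtain ⟨c, hc⟩ := (Submodule.mem_span_image_finset_iff_exists_fun k[X]).1 hv
  refine ⟨n, fun i => if h : i ∈ Finset.range n then - (c ⟨i, h⟩ * q ^ i) else q ^ n,
    by simpa using fun h => absurd h hq, ?_⟩
  have hc' := congrArg (Subtype.val) hc
  rw [AddSubmonoidClass.coe_finsetSum] at hc'
  beta_reduce
  rw [Finset.sum_range_succ, dif_neg (by simp), ← polynomial_smul_def,
    show q ^ n • (PowerSeries.derivative k)^[n] f = (v n : k⟦X⟧) from rfl, ← hc',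
    ← Finset.sum_coe_sort, ← Finset.sum_add_distrib]
  refine Finset.sum_eq_zero fun i _ => ?_
  rw [dif_pos i.2, ← polynomial_smul_def, neg_smul, mul_smul]
  exact neg_add_cancel _

/-- The span of f, …, f^(r-1) is stable under p_r d/dX, the relation rewriting p_r f^(r). For r = 0
the relation forces f = 0. -/
theorem isDFinite_of_relation {f : k⟦X⟧} {r : ℕ} {p : ℕ → k[X]} (hr : p r ≠ 0)
    (h : ∑ i ∈ Finset.range (r + 1), (p i : k⟦X⟧) * (PowerSeries.derivative k)^[i] f = 0) :
    IsDFinite f := by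
  rcases Nat.eq_zero_or_pos r with rfl | hr0
  · have hf : f = 0 := by simpa [hr] using h
    rw [hf]
    simpa using isDFinite_polynomial (0 : k[X])
  refine ⟨(fun i => (PowerSeries.derivative k)^[i] f) '' (Finset.range r : Set ℕ), p r,
    (Finset.finite_toSet _).image _, hr, Submodule.subset_span ⟨0, by simpa using hr0, rfl⟩,
    smul_derivative_mem_span Submodule.subset_span ?_⟩
  rintro _ ⟨i, hi, rfl⟩
  have hi' : i < r := by simpa using hi
  have hmem : ∀ j < r, (PowerSeries.derivative k)^[j] f ∈ Submodule.span k[X]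
      ((fun i => (PowerSeries.derivative k)^[i] f) '' (Finset.range r : Set ℕ)) :=
    fun j hj => Submodule.subset_span ⟨j, by simpa using hj, rfl⟩
  change p r • PowerSeries.derivative k ((PowerSeries.derivative k)^[i] f) ∈ _
  rw [← Function.iterate_succ_apply' (PowerSeries.derivative k)]
  rcases Nat.lt_or_ge (i + 1) r with hlt | hge
  · exact Submodule.smul_mem _ _ (hmem _ hlt)
  · obtain rfl : r = i + 1 := by omega
    rw [Finset.sum_range_succ] at h
    rw [polynomial_smul_def, eq_neg_of_add_eq_zero_right h]
    refine Submodule.neg_mem _ (Submodule.sum_mem _ fun j hj => ?_)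
    rw [← polynomial_smul_def]
    exact Submodule.smul_mem _ _ (hmem _ (Finset.mem_range.1 hj))

end DFinite

theorem isHolonomic_iff_isDFinite {f : PowerSeries Qbar} : IsHolonomic f ↔ IsDFinite f :=
  ⟨fun ⟨_, _, hr, h⟩ => isDFinite_of_relation hr h, fun h => h.exists_relation⟩

end GSeries

/-! ### Sizes and denominators of coefficients; closure properties of G-functions -/

namespace GSeries

open scoped Polynomial PowerSeries Pointwise

theorem isAlgebraic_rat_Qbar (a : Qbar) : IsAlgebraic ℚ a :=
  (algebraicClosure.isAlgebraic ℚ ℂ).isAlgebraic a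

/-- All conjugates are roots of one and the same rational polynomial. -/
theorem exists_bound_conjugates (a : Qbar) : ∃ K : ℝ, ∀ σ : Qbar →+* ℂ, ‖σ a‖ ≤ K := by
  obtain ⟨p, hp0, hp⟩ := isAlgebraic_rat_Qbar a
  have hfin : {z : ℂ | z ∈ p.rootSet ℂ}.Finite := Polynomial.rootSet_finite p ℂ
  obtain ⟨K, hK⟩ := (hfin.image (fun z => ‖z‖)).bddAbove
  refine ⟨K, fun σ => hK ⟨σ a, ?_, rfl⟩⟩
  have h1 := congrArg σ hp
  rw [Polynomial.aeval_def, Polynomial.hom_eval₂, map_zero] at h1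
  refine (Polynomial.mem_rootSet_of_ne hp0).2 ?_
  rw [Polynomial.aeval_def, ← h1]
  congr 1
  exact Subsingleton.elim _ _

theorem exists_denominator (a : Qbar) : ∃ D : ℤ, D ≠ 0 ∧ IsIntegral ℤ ((D : Qbar) * a) := by
  obtain ⟨y, hy, h⟩ :=
    ((IsFractionRing.isAlgebraic_iff ℤ ℚ Qbar).2 (isAlgebraic_rat_Qbar a)).exists_integral_multiple
  exact ⟨y, hy, by rwa [← zsmul_eq_mul]⟩

theorem isIntegral_intCast_mul {a : Qbar} {D : ℤ} (h : IsIntegral ℤ ((D : Qbar) * a)) (E : ℤ) :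
    IsIntegral ℤ (((E * D : ℤ) : Qbar) * a) := by
  rw [Int.cast_mul, mul_assoc]
  exact (isIntegral_algebraMap (x := E)).mul h

theorem exists_denominator_polynomial (φ : Qbar[X]) :
    ∃ D : ℤ, D ≠ 0 ∧ ∀ i, IsIntegral ℤ ((D : Qbar) * φ.coeff i) := by
  choose D hD hDi using exists_denominator
  refine ⟨∏ i ∈ φ.support, D (φ.coeff i), Finset.prod_ne_zero_iff.2 fun i _ => hD _, fun i => ?_⟩
  by_cases hi : i ∈ φ.support
  · rw [← Finset.prod_erase_mul _ _ hi]
    exact isIntegral_intCast_mul (hDi _) _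
  · rw [Polynomial.notMem_support_iff.1 hi, mul_zero]
    exact isIntegral_zero

theorem exists_bound_polynomial (φ : Qbar[X]) :
    ∃ K : ℝ, 0 ≤ K ∧ ∀ (i : ℕ) (σ : Qbar →+* ℂ), ‖σ (φ.coeff i)‖ ≤ K := by
  choose K hK using exists_bound_conjugates
  have hK0 : ∀ a, 0 ≤ K a := fun a => (norm_nonneg _).trans (hK a (algebraMap Qbar ℂ))
  refine ⟨∑ i ∈ φ.support, K (φ.coeff i), Finset.sum_nonneg fun i _ => hK0 _, fun i σ => ?_⟩
  by_cases hi : i ∈ φ.support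
  · exact (hK _ σ).trans (Finset.single_le_sum (f := fun i => K (φ.coeff i))
      (fun i _ => hK0 _) hi)
  · rw [Polynomial.notMem_support_iff.1 hi, map_zero, norm_zero]
    exact Finset.sum_nonneg fun i _ => hK0 _

/-- All conjugates of the `n`-th coefficient are bounded by `C ^ (n + 1)`. -/
def SizeBounded (f : PowerSeries Qbar) : Prop :=
  ∃ C : ℝ, 1 ≤ C ∧ ∀ (n : ℕ) (σ : Qbar →+* ℂ), ‖σ (PowerSeries.coeff n f)‖ ≤ C ^ (n + 1)

/-- The first coefficients have a common denominator of at most exponential growth. -/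
def DenomBounded (f : PowerSeries Qbar) : Prop :=
  ∃ C : ℝ, 1 ≤ C ∧ ∃ d : ℕ → ℤ, ∀ n : ℕ, d n ≠ 0 ∧ |(d n : ℝ)| ≤ C ^ (n + 1) ∧
      ∀ m ≤ n, IsIntegral ℤ ((d n : Qbar) * PowerSeries.coeff m f)

theorem isGFunction_iff {f : PowerSeries Qbar} :
    IsGFunction f ↔ SizeBounded f ∧ DenomBounded f ∧ IsDFinite f := by
  rw [← isHolonomic_iff_isDFinite]
  constructor
  · rintro ⟨⟨C, hC, h1, d, h2⟩, h3⟩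
    have hle : ∀ n : ℕ, C ^ (n + 1) ≤ (max 1 C) ^ (n + 1) := fun n =>
      pow_le_pow_left₀ hC.le (le_max_right _ _) _
    exact ⟨⟨max 1 C, le_max_left _ _, fun n σ => (h1 n σ).trans (hle n)⟩,
      ⟨max 1 C, le_max_left _ _, d, fun n => ⟨(h2 n).1, (h2 n).2.1.trans (hle n), (h2 n).2.2⟩⟩, h3⟩
  · rintro ⟨⟨C, hC, h1⟩, ⟨C', hC', d, h2⟩, h3⟩
    have hC0 : (0 : ℝ) < max C C' := (zero_lt_one.trans_le hC).trans_le (le_max_left _ _)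
    refine ⟨⟨max C C', hC0, fun n σ => (h1 n σ).trans
      (pow_le_pow_left₀ (zero_le_one.trans hC) (le_max_left _ _) _), d, fun n =>
      ⟨(h2 n).1, (h2 n).2.1.trans
        (pow_le_pow_left₀ (zero_le_one.trans hC') (le_max_right _ _) _), (h2 n).2.2⟩⟩, h3⟩

theorem mul_pow_le_pow_succ {A B : ℝ} (hA : 0 ≤ A) (hB : 0 ≤ B) (n : ℕ) :
    A * B ^ n ≤ (1 + A + B) ^ (n + 1) := by
  rw [pow_succ']
  have h1 : A ≤ 1 + A + B := by linarith
  have h2 : B ≤ 1 + A + B := by linarith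
  gcongr

theorem sizeBounded_of_le {f : PowerSeries Qbar} {A B : ℝ} (hA : 0 ≤ A) (hB : 0 ≤ B)
    (h : ∀ (n : ℕ) (σ : Qbar →+* ℂ), ‖σ (PowerSeries.coeff n f)‖ ≤ A * B ^ n) :
    SizeBounded f :=
  ⟨1 + A + B, by linarith, fun n σ => (h n σ).trans (mul_pow_le_pow_succ hA hB n)⟩

theorem denomBounded_of_le {f : PowerSeries Qbar} {A B : ℝ} (hA : 0 ≤ A) (hB : 0 ≤ B)
    (d : ℕ → ℤ) (h0 : ∀ n, d n ≠ 0) (h : ∀ n : ℕ, |(d n : ℝ)| ≤ A * B ^ n)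
    (hd : ∀ n : ℕ, ∀ m ≤ n, IsIntegral ℤ ((d n : Qbar) * PowerSeries.coeff m f)) :
    DenomBounded f :=
  ⟨1 + A + B, by linarith, d, fun n =>
    ⟨h0 n, (h n).trans (mul_pow_le_pow_succ hA hB n), hd n⟩⟩

theorem sizeBounded_polynomial (φ : Qbar[X]) : SizeBounded (φ : PowerSeries Qbar) := by
  obtain ⟨K, hK, h⟩ := exists_bound_polynomial φ
  exact sizeBounded_of_le hK zero_le_one fun n σ => by simpa using h n σ

theorem denomBounded_polynomial (φ : Qbar[X]) : DenomBounded (φ : PowerSeries Qbar) := by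
  obtain ⟨D, hD, h⟩ := exists_denominator_polynomial φ
  exact denomBounded_of_le (abs_nonneg (D : ℝ)) zero_le_one (fun _ => D) (fun _ => hD)
    (fun n => by simp) fun n m _ => by simpa using h m

theorem isGFunction_polynomial (φ : Qbar[X]) : IsGFunction (φ : PowerSeries Qbar) :=
  isGFunction_iff.2 ⟨sizeBounded_polynomial φ, denomBounded_polynomial φ, isDFinite_polynomial φ⟩

theorem SizeBounded.add {f g : PowerSeries Qbar} (hf : SizeBounded f) (hg : SizeBounded g) :
    SizeBounded (f + g) := by
  obtain ⟨C, hC, h⟩ := hf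
  obtain ⟨E, hE, h'⟩ := hg
  refine sizeBounded_of_le (A := C + E) (B := C + E) (by linarith) (by linarith) fun n σ => ?_
  rw [map_add, map_add, ← pow_succ']
  exact (norm_add_le _ _).trans ((add_le_add (h n σ) (h' n σ)).trans
    (pow_add_pow_le (by linarith) (by linarith) (Nat.succ_ne_zero n)))

theorem SizeBounded.mul {f g : PowerSeries Qbar} (hf : SizeBounded f) (hg : SizeBounded g) :
    SizeBounded (f * g) := by
  obtain ⟨C, hC, h⟩ := hf
  obtain ⟨E, hE, h'⟩ := hg
  refine sizeBounded_of_le (A := C * E) (B := 2 * (C * E)) (by positivity) (by positivity)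
    fun n σ => ?_
  rw [PowerSeries.coeff_mul, map_sum]
  have hb : ∀ p ∈ Finset.HasAntidiagonal.antidiagonal n,
      ‖σ (PowerSeries.coeff p.1 f * PowerSeries.coeff p.2 g)‖ ≤ (C * E) ^ (n + 1) := by
    intro p hp
    have hp := Finset.HasAntidiagonal.mem_antidiagonal.1 hp
    rw [map_mul, norm_mul, mul_pow]
    refine mul_le_mul ((h _ σ).trans (pow_le_pow_right₀ hC (by omega)))
      ((h' _ σ).trans (pow_le_pow_right₀ hE (by omega))) (norm_nonneg _) (by positivity)
  refine (norm_sum_le_of_le _ hb).trans ?_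
  rw [Finset.sum_const, Finset.Nat.card_antidiagonal, nsmul_eq_mul]
  have h2 : ((n + 1 : ℕ) : ℝ) ≤ 2 ^ n := by exact_mod_cast Nat.lt_two_pow_self (n := n)
  calc ((n + 1 : ℕ) : ℝ) * (C * E) ^ (n + 1) ≤ 2 ^ n * (C * E) ^ (n + 1) := by gcongr
    _ = C * E * (2 * (C * E)) ^ n := by rw [mul_pow 2]; ring

/-- The products of the two denominators serve for k. Since hypotheses for all m ≤ n restrict to
smaller n, only the last coefficient has to be tested. -/
theorem DenomBounded.combine {f g k : PowerSeries Qbar} (hf : DenomBounded f)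
    (hg : DenomBounded g) (hk : ∀ (n : ℕ) (d e : ℤ),
      (∀ m ≤ n, IsIntegral ℤ ((d : Qbar) * PowerSeries.coeff m f)) →
      (∀ m ≤ n, IsIntegral ℤ ((e : Qbar) * PowerSeries.coeff m g)) →
      IsIntegral ℤ (((d * e : ℤ) : Qbar) * PowerSeries.coeff n k)) : DenomBounded k := by
  obtain ⟨C, hC, d, h⟩ := hf
  obtain ⟨E, hE, e, h'⟩ := hg
  refine denomBounded_of_le (A := C * E) (B := C * E) (by positivity) (by positivity)
    (fun n => d n * e n) (fun n => mul_ne_zero (h n).1 (h' n).1) (fun n => ?_)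
    fun n m hm => hk m _ _ (fun i hi => (h n).2.2 i (hi.trans hm))
      fun i hi => (h' n).2.2 i (hi.trans hm)
  rw [Int.cast_mul, abs_mul, ← pow_succ', mul_pow]
  exact mul_le_mul (h n).2.1 (h' n).2.1 (abs_nonneg _) (by positivity)

theorem DenomBounded.add {f g : PowerSeries Qbar} (hf : DenomBounded f) (hg : DenomBounded g) :
    DenomBounded (f + g) := by
  refine hf.combine hg fun n d e h h' => ?_
  rw [map_add, mul_add]
  refine IsIntegral.add ?_ ?_
  · rw [mul_comm d e]; exact isIntegral_intCast_mul (h n le_rfl) _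
  · exact isIntegral_intCast_mul (h' n le_rfl) _

theorem DenomBounded.mul {f g : PowerSeries Qbar} (hf : DenomBounded f) (hg : DenomBounded g) :
    DenomBounded (f * g) := by
  refine hf.combine hg fun n d e h h' => ?_
  rw [PowerSeries.coeff_mul, Finset.mul_sum]
  refine IsIntegral.sum _ fun p hp => ?_
  have hp := Finset.HasAntidiagonal.mem_antidiagonal.1 hp
  rw [Int.cast_mul, mul_mul_mul_comm]
  exact (h _ (by omega)).mul (h' _ (by omega))

theorem IsGFunction.add {f g : PowerSeries Qbar} (hf : IsGFunction f) (hg : IsGFunction g) :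
    IsGFunction (f + g) := by
  rw [isGFunction_iff] at *
  exact ⟨hf.1.add hg.1, hf.2.1.add hg.2.1, hf.2.2.add hg.2.2⟩

theorem IsGFunction.mul {f g : PowerSeries Qbar} (hf : IsGFunction f) (hg : IsGFunction g) :
    IsGFunction (f * g) := by
  rw [isGFunction_iff] at *
  exact ⟨hf.1.mul hg.1, hf.2.1.mul hg.2.1, hf.2.2.mul hg.2.2⟩

theorem coeff_pow_eq_zero_of_lt {φ : Qbar[X]} (hφ : φ.coeff 0 = 0) {d e : ℕ} (h : e < d) :
    (φ ^ d).coeff e = 0 := by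
  obtain ⟨ψ, rfl⟩ := Polynomial.X_dvd_iff.2 hφ
  rw [mul_pow, Polynomial.coeff_X_pow_mul', if_neg (by omega)]

/-- The power φ^d starts in degree at least d, so only d ≤ e contribute to the coefficient. -/
theorem coeff_subst_polynomial {φ : Qbar[X]} (hφ : φ.coeff 0 = 0) (f : PowerSeries Qbar) (e : ℕ) :
    PowerSeries.coeff e (f.subst (φ : PowerSeries Qbar)) =
      ∑ d ∈ Finset.range (e + 1), PowerSeries.coeff d f * (φ ^ d).coeff e := by
  rw [PowerSeries.coeff_subst' (PowerSeries.HasSubst.of_constantCoeff_zero' (by simpa using hφ)),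
    finsum_eq_sum_of_support_subset (s := Finset.range (e + 1))]
  · refine Finset.sum_congr rfl fun d _ => ?_
    rw [smul_eq_mul, ← Polynomial.coe_pow, Polynomial.coeff_coe]
  · intro d hd
    by_contra hlt
    refine hd ?_
    beta_reduce
    rw [← Polynomial.coe_pow, Polynomial.coeff_coe, coeff_pow_eq_zero_of_lt hφ (by simpa using hlt),
      smul_zero]

/-- The sum of the absolute values of the coefficients is at most (deg φ + 1) K and bounds each
convolution step. The added 1 makes the base at least 1, so that exponents may be enlarged later. -/
theorem norm_coeff_pow_le {φ : Qbar[X]} {K : ℝ} {σ : Qbar →+* ℂ}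
    (h : ∀ i : ℕ, ‖σ (φ.coeff i)‖ ≤ K) (hK : 0 ≤ K) (d e : ℕ) :
    ‖σ ((φ ^ d).coeff e)‖ ≤ ((φ.natDegree + 1) * K + 1) ^ d := by
  induction d generalizing e with
  | zero =>
    rw [pow_zero, pow_zero, Polynomial.coeff_one]
    split_ifs <;> simp
  | succ d ih =>
    set B : ℝ := (φ.natDegree + 1) * K + 1
    have hB : 0 ≤ B := by positivity
    rw [pow_succ', Polynomial.coeff_mul, map_sum, Finset.Nat.sum_antidiagonal_eq_sum_range_succ_mk]
    have h1 : ∀ i ∈ Finset.range e.succ, ‖σ (φ.coeff i * (φ ^ d).coeff (e - i))‖ ≤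
        ‖σ (φ.coeff i)‖ * B ^ d := fun i _ => by
      rw [map_mul, norm_mul]
      exact mul_le_mul_of_nonneg_left (ih _) (norm_nonneg _)
    refine (norm_sum_le_of_le _ h1).trans ?_
    rw [← Finset.sum_mul, pow_succ' B]
    refine mul_le_mul_of_nonneg_right ?_ (by positivity)
    have h2 : ∑ i ∈ Finset.range e.succ, ‖σ (φ.coeff i)‖ ≤
        ∑ i ∈ Finset.range (φ.natDegree + 1), ‖σ (φ.coeff i)‖ := by
      rw [← Finset.sum_filter_ne_zero]
      refine Finset.sum_le_sum_of_subset_of_nonneg (fun i hi => ?_) fun i _ _ => norm_nonneg _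
      rw [Finset.mem_range, Nat.lt_succ_iff]
      by_contra hlt
      have hi := (Finset.mem_filter.1 hi).2
      rw [Polynomial.coeff_eq_zero_of_natDegree_lt (by omega), map_zero, norm_zero] at hi
      exact hi rfl
    refine h2.trans ((Finset.sum_le_sum fun i _ => h i).trans ?_)
    simp [B]

theorem isIntegral_coeff_pow {φ : Qbar[X]} {D : ℤ}
    (h : ∀ i, IsIntegral ℤ ((D : Qbar) * φ.coeff i)) (d e : ℕ) :
    IsIntegral ℤ ((D : Qbar) ^ d * (φ ^ d).coeff e) := by
  induction d generalizing e with
  | zero =>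
    rw [pow_zero, pow_zero, one_mul, Polynomial.coeff_one]
    split_ifs
    exacts [isIntegral_one, isIntegral_zero]
  | succ d ih =>
    rw [pow_succ', pow_succ', Polynomial.coeff_mul, Finset.mul_sum]
    refine IsIntegral.sum _ fun p _ => ?_
    rw [mul_mul_mul_comm]
    exact (h _).mul (ih _)

theorem SizeBounded.subst {f : PowerSeries Qbar} (hf : SizeBounded f) {φ : Qbar[X]}
    (hφ : φ.coeff 0 = 0) : SizeBounded (f.subst (φ : PowerSeries Qbar)) := by
  obtain ⟨C, hC, h⟩ := hf
  obtain ⟨K, hK, h'⟩ := exists_bound_polynomial φ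
  set B : ℝ := (φ.natDegree + 1) * K + 1
  have hB : 1 ≤ B := le_add_of_nonneg_left (by positivity)
  refine sizeBounded_of_le (A := C) (B := 2 * (C * B)) (by positivity) (by positivity)
    fun n σ => ?_
  rw [coeff_subst_polynomial hφ, map_sum]
  have hb : ∀ d ∈ Finset.range (n + 1), ‖σ (PowerSeries.coeff d f * (φ ^ d).coeff n)‖ ≤
      C ^ (n + 1) * B ^ n := by
    intro d hd
    have hd := Finset.mem_range.1 hd
    rw [map_mul, norm_mul]
    refine mul_le_mul ((h _ σ).trans (pow_le_pow_right₀ hC (by omega)))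
      ((norm_coeff_pow_le (fun i => h' i σ) hK d n).trans (pow_le_pow_right₀ hB (by omega)))
      (norm_nonneg _) (by positivity)
  refine (norm_sum_le_of_le _ hb).trans ?_
  rw [Finset.sum_const, Finset.card_range, nsmul_eq_mul]
  have h2 : ((n + 1 : ℕ) : ℝ) ≤ 2 ^ n := by exact_mod_cast Nat.lt_two_pow_self (n := n)
  calc ((n + 1 : ℕ) : ℝ) * (C ^ (n + 1) * B ^ n) ≤ 2 ^ n * (C ^ (n + 1) * B ^ n) := by gcongr
    _ = C * (2 * (C * B)) ^ n := by rw [mul_pow 2, mul_pow]; ring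

theorem DenomBounded.subst {f : PowerSeries Qbar} (hf : DenomBounded f) {φ : Qbar[X]}
    (hφ : φ.coeff 0 = 0) : DenomBounded (f.subst (φ : PowerSeries Qbar)) := by
  obtain ⟨C, hC, d, h⟩ := hf
  obtain ⟨D, hD, h'⟩ := exists_denominator_polynomial φ
  refine denomBounded_of_le (A := C) (B := C * |(D : ℝ)|) (by positivity) (by positivity)
    (fun n => d n * D ^ n) (fun n => mul_ne_zero (h n).1 (pow_ne_zero _ hD)) (fun n => ?_)
    fun n m hm => ?_
  · rw [Int.cast_mul, abs_mul, Int.cast_pow, abs_pow, mul_pow, ← mul_assoc, ← pow_succ']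
    exact mul_le_mul_of_nonneg_right (h n).2.1 (by positivity)
  · rw [coeff_subst_polynomial hφ, Finset.mul_sum]
    refine IsIntegral.sum _ fun i hi => ?_
    have hi := Finset.mem_range.1 hi
    obtain ⟨j, rfl⟩ : ∃ j, n = j + i := ⟨n - i, by omega⟩
    -- With n = j + i: `d n` clears the coefficient of f, D^i clears φ^i, and D^j is left over.
    rw [show ((d (j + i) * D ^ (j + i) : ℤ) : Qbar) *
      (PowerSeries.coeff i f * (φ ^ i).coeff m) =
      ((d (j + i) : Qbar) * PowerSeries.coeff i f) * (((D ^ j : ℤ) : Qbar) *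
        ((D : Qbar) ^ i * (φ ^ i).coeff m)) by push_cast; ring]
    exact ((h _).2.2 _ (by omega)).mul
      ((isIntegral_algebraMap (x := D ^ j)).mul (isIntegral_coeff_pow h' _ _))

theorem IsGFunction.subst {f : PowerSeries Qbar} (hf : IsGFunction f) {φ : Qbar[X]}
    (hφ : φ.coeff 0 = 0) : IsGFunction (f.subst (φ : PowerSeries Qbar)) := by
  rw [isGFunction_iff] at *
  exact ⟨hf.1.subst hφ, hf.2.1.subst hφ, hf.2.2.subst hφ⟩

/-! ### Inverting the operator z d/dz + s on G-functions -/

/-- The power series `∑ a_n / (n + s) z ^ n`, for which `z g' + s g = f`. -/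
noncomputable def eulerInverse (s : ℚ) (f : PowerSeries Qbar) : PowerSeries Qbar :=
  PowerSeries.mk fun n => PowerSeries.coeff n f * ((((n : ℚ) + s)⁻¹ : ℚ) : Qbar)

theorem natCast_add_ne_zero {s : ℚ} (hs : s ∈ admissible) (n : ℕ) : (n : ℚ) + s ≠ 0 := by
  intro h
  exact hs n (by linarith)

theorem natCast_add_eq (s : ℚ) (n : ℕ) : (n : ℚ) + s = ((n * s.den + s.num : ℤ) : ℚ) / s.den := by
  have : (s.den : ℚ) ≠ 0 := by exact_mod_cast s.den_ne_zero
  field_simp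
  push_cast
  rw [add_mul, Rat.mul_den_eq_num]

theorem num_ne_zero_of_admissible {s : ℚ} (hs : s ∈ admissible) (n : ℕ) :
    (n * s.den + s.num : ℤ) ≠ 0 := by
  intro h
  have := natCast_add_eq s n
  rw [h, Int.cast_zero, zero_div] at this
  exact natCast_add_ne_zero hs n this

theorem isDFinite_eulerInverse {f : PowerSeries Qbar} (hf : IsDFinite f) {s : ℚ}
    (hs : s ∈ admissible) : IsDFinite (eulerInverse s f) := by
  refine IsDFinite.of_first_order (q := Polynomial.X) (r := Polynomial.C (s : Qbar))
    Polynomial.X_ne_zero ?_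
  convert hf using 1
  ext1 n
  have h0 : ((n : Qbar) + (s : Qbar)) ≠ 0 := by exact_mod_cast natCast_add_ne_zero hs n
  rw [polynomial_smul_def, polynomial_smul_def, map_add, Polynomial.coe_X, Polynomial.coe_C,
    PowerSeries.coeff_C_mul]
  have h1 : PowerSeries.coeff n (PowerSeries.X * PowerSeries.derivative Qbar (eulerInverse s f)) =
      n * PowerSeries.coeff n (eulerInverse s f) := by
    cases n with
    | zero => simp
    | succ n =>
      rw [PowerSeries.coeff_succ_X_mul, PowerSeries.coeff_derivative]
      push_cast
      ring
  rw [h1, eulerInverse, PowerSeries.coeff_mk]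
  push_cast
  field_simp

/-- Chebyshev's bound: log lcm(1, …, n) = ψ(n) is at most a constant times n. -/
theorem lcmUpto_le_pow : ∃ B : ℝ, 1 ≤ B ∧ ∀ n : ℕ, (Nat.lcmUpto n : ℝ) ≤ B ^ n := by
  refine ⟨Real.exp (Real.log 4 + 4), Real.one_le_exp (by positivity), fun n => ?_⟩
  have h := Chebyshev.psi_le_const_mul_self (x := n) (by positivity)
  rw [Chebyshev.psi_eq_log_lcmUpto, Real.log_le_iff_le_exp
    (by exact_mod_cast Nat.lcmUpto_pos n)] at h
  rwa [← Real.exp_nat_mul, mul_comm]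

theorem norm_inv_natCast_add_le {s : ℚ} (hs : s ∈ admissible) (n : ℕ) :
    ‖(((((n : ℚ) + s)⁻¹ : ℚ)) : ℂ)‖ ≤ s.den := by
  rw [natCast_add_eq, inv_div]
  have h2 : (1 : ℝ) ≤ |((n * s.den + s.num : ℤ) : ℝ)| := by
    exact_mod_cast Int.one_le_abs (num_ne_zero_of_admissible hs n)
  rw [Rat.cast_div, norm_div, Rat.cast_natCast, Complex.norm_natCast, Rat.cast_intCast,
    Complex.norm_intCast]
  exact div_le_self (by positivity) h2

theorem sizeBounded_eulerInverse {f : PowerSeries Qbar} (hf : SizeBounded f) {s : ℚ}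
    (hs : s ∈ admissible) : SizeBounded (eulerInverse s f) := by
  obtain ⟨C, hC, h⟩ := hf
  refine sizeBounded_of_le (A := C * s.den) (B := C) (by positivity) (by positivity) fun n σ => ?_
  rw [eulerInverse, PowerSeries.coeff_mk, map_mul, norm_mul, map_ratCast]
  have h1 := norm_inv_natCast_add_le hs n
  calc _ ≤ C ^ (n + 1) * s.den := mul_le_mul (h n σ) h1 (norm_nonneg _) (by positivity)
    _ = _ := by ring

/-- For s = p/q one has 1/(m + s) = q/(mq + p), and for m ≤ n the nonzero integer mq + p divides
lcm(1, …, nq + |p|), which grows exponentially in n. -/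
theorem denomBounded_eulerInverse {f : PowerSeries Qbar} (hf : DenomBounded f) {s : ℚ}
    (hs : s ∈ admissible) : DenomBounded (eulerInverse s f) := by
  obtain ⟨C, hC, d, h⟩ := hf
  obtain ⟨B, hB, hB'⟩ := lcmUpto_le_pow
  refine denomBounded_of_le (A := C * B ^ s.num.natAbs) (B := C * B ^ s.den)
    (by positivity) (by positivity) (fun n => d n * Nat.lcmUpto (n * s.den + s.num.natAbs))
    (fun n => mul_ne_zero (h n).1 (by exact_mod_cast Nat.lcmUpto_ne_zero _)) (fun n => ?_)
    fun n m hm => ?_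
  · rw [Int.cast_mul, abs_mul, Int.cast_natCast, Nat.abs_cast]
    calc _ ≤ C ^ (n + 1) * B ^ (n * s.den + s.num.natAbs) :=
          mul_le_mul (h n).2.1 (hB' _) (by positivity) (by positivity)
      _ = _ := by rw [mul_pow, pow_add B, mul_comm n, pow_mul]; ring
  · rw [eulerInverse, PowerSeries.coeff_mk, natCast_add_eq, inv_div, Int.cast_mul,
      mul_mul_mul_comm]
    refine ((h n).2.2 m hm).mul ?_
    have hne := num_ne_zero_of_admissible hs m
    have hdvd : (m * s.den + s.num : ℤ) ∣ Nat.lcmUpto (n * s.den + s.num.natAbs) := by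
      rw [← Int.natAbs_dvd_natAbs, Int.natAbs_natCast]
      refine Finset.dvd_lcm (f := id) (Finset.mem_Icc.2 ⟨Int.natAbs_pos.2 hne, ?_⟩)
      refine (Int.natAbs_add_le _ _).trans ?_
      rw [Int.natAbs_mul, Int.natAbs_natCast, Int.natAbs_natCast]
      gcongr
    obtain ⟨c, hc⟩ := hdvd
    rw [hc]
    have hne' : ((m * s.den + s.num : ℤ) : Qbar) ≠ 0 := by exact_mod_cast hne
    have : ((((m * s.den + s.num : ℤ) * c : ℤ) : Qbar) *
        ((((s.den : ℚ) / ((m * s.den + s.num : ℤ) : ℚ) : ℚ)) : Qbar)) =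
        algebraMap ℤ Qbar (c * s.den) := by
      rw [Rat.cast_div, Rat.cast_intCast, Int.cast_mul]
      simp only [Rat.cast_natCast, eq_intCast, Int.cast_mul, Int.cast_natCast]
      field_simp
    rw [this]
    exact isIntegral_algebraMap

theorem IsGFunction.eulerInverse {f : PowerSeries Qbar} (hf : IsGFunction f) {s : ℚ}
    (hs : s ∈ admissible) : IsGFunction (eulerInverse s f) := by
  rw [isGFunction_iff] at *
  exact ⟨sizeBounded_eulerInverse hf.1 hs, denomBounded_eulerInverse hf.2.1 hs,
    isDFinite_eulerInverse hf.2.2 hs⟩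

end GSeries

/-! ### Binomial series with rational exponent -/

namespace GSeries

open scoped Polynomial PowerSeries

theorem succ_mul_choose (c : ℚ) (n : ℕ) :
    (n + 1 : ℚ) * Ring.choose c (n + 1) = (c - n) * Ring.choose c n := by
  have h1 := Ring.descPochhammer_eq_factorial_smul_choose c n
  have h2 := Ring.descPochhammer_eq_factorial_smul_choose c (n + 1)
  rw [descPochhammer_succ_right, Polynomial.smeval_mul, h1, Polynomial.smeval_sub,
    Polynomial.smeval_X, Polynomial.smeval_natCast, Nat.factorial_succ] at h2
  have h3 : (n.factorial : ℚ) ≠ 0 := by exact_mod_cast n.factorial_ne_zero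
  simp only [nsmul_eq_mul, Nat.cast_mul, Nat.cast_add, Nat.cast_one, pow_one, pow_zero,
    mul_one] at h2
  apply mul_left_cancel₀ h3
  linear_combination -h2

theorem abs_choose_le (c : ℚ) (n : ℕ) : |Ring.choose c n| ≤ (1 + |c|) ^ n := by
  induction n with
  | zero => simp
  | succ n ih =>
    have h := congrArg abs (succ_mul_choose c n)
    rw [abs_mul, abs_mul, abs_of_nonneg (by positivity : (0 : ℚ) ≤ n + 1)] at h
    have h2 : |c - n| ≤ (n + 1) * (1 + |c|) := by
      have h3 := abs_sub c (n : ℚ)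
      rw [Nat.abs_cast] at h3
      nlinarith [mul_nonneg (Nat.cast_nonneg (α := ℚ) n) (abs_nonneg c)]
    have h4 : (n + 1 : ℚ) * |Ring.choose c (n + 1)| ≤ (n + 1) * (1 + |c|) ^ (n + 1) := by
      rw [h, pow_succ', ← mul_assoc]
      exact mul_le_mul h2 ih (abs_nonneg _) (by positivity)
    exact le_of_mul_le_mul_left h4 (by positivity)

theorem factorial_mul_choose (c : ℚ) (n : ℕ) :
    (n.factorial : ℚ) * c.den ^ n * Ring.choose c n =
      ((∏ i ∈ Finset.range n, (c.num - i * c.den) : ℤ) : ℚ) := by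
  induction n with
  | zero => simp
  | succ n ih =>
    rw [Finset.prod_range_succ, Int.cast_mul, ← ih, Nat.factorial_succ, pow_succ]
    push_cast
    have h := succ_mul_choose c n
    have h2 : (c.num : ℚ) = c * c.den := (Rat.mul_den_eq_num c).symm
    rw [h2]
    linear_combination (n.factorial * c.den ^ n * c.den : ℚ) * h

theorem factorial_dvd_prod_sub (m : ℤ) (n : ℕ) :
    (n.factorial : ℤ) ∣ ∏ i ∈ Finset.range n, (m - i) := by
  have h := factorial_mul_choose m n
  simp only [Rat.den_intCast, Rat.num_intCast, Nat.cast_one, one_pow, mul_one] at h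
  have h2 : ((Ring.choose m n : ℤ) : ℚ) = Ring.choose (m : ℚ) n :=
    Ring.map_choose (algebraMap ℤ ℚ) m n
  rw [← h2] at h
  exact ⟨Ring.choose m n, by exact_mod_cast h.symm⟩

/-- Argue one prime l at a time. If l divides q, then q^n absorbs the l-part of n!, whose exponent
is at most n. Otherwise q has an inverse a modulo l^k, and p - iq ≡ (ap - i)q turns the product into
a power of q times n consecutive integers, divisible by n!. -/
theorem factorial_dvd_pow_mul_prod (p : ℤ) (q : ℕ) (n : ℕ) :
    (n.factorial : ℤ) ∣ (q : ℤ) ^ n * ∏ i ∈ Finset.range n, (p - i * q) := by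
  rw [Int.natCast_dvd, Nat.dvd_iff_prime_pow_dvd_dvd]
  intro l k hl hk
  have := Fact.mk hl
  rw [← Int.natCast_dvd]
  by_cases hlq : l ∣ q
  · have hkn : k ≤ n := by
      refine le_trans ?_ (padicValNat_factorial_le (p := l) n)
      exact (padicValNat_dvd_iff_le n.factorial_ne_zero).1 hk
    refine Dvd.dvd.mul_right ?_ _
    exact_mod_cast (pow_dvd_pow_of_dvd hlq k).trans (pow_dvd_pow q hkn)
  · have hcop : IsCoprime (q : ℤ) ((l ^ k : ℕ) : ℤ) := by
      rw [Nat.isCoprime_iff_coprime]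
      exact (((Nat.Prime.coprime_iff_not_dvd hl).2 hlq).pow_left k).symm
    obtain ⟨a, b, hab⟩ := hcop
    refine Dvd.dvd.mul_left ?_ _
    have h1 : ∏ i ∈ Finset.range n, (p - i * q) ≡
        ∏ i ∈ Finset.range n, ((a * p - i) * q) [ZMOD (l ^ k : ℕ)] := by
      refine Int.ModEq.prod fun i _ => ?_
      refine (Int.modEq_iff_dvd.2 ⟨- (b * p), ?_⟩)
      linear_combination p * hab
    refine (Int.modEq_zero_iff_dvd.1 (h1.trans (Int.modEq_zero_iff_dvd.2 ?_)))
    rw [Finset.prod_mul_distrib]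
    exact Dvd.dvd.mul_right ((Int.natCast_dvd_natCast.2 hk).trans (factorial_dvd_prod_sub _ _)) _

/-- One factor `c.den ^ n` clears the numerators c - i, a second one the part of n! not cancelled by
them. -/
theorem exists_int_eq_pow_mul_choose (c : ℚ) (n : ℕ) :
    ∃ z : ℤ, (c.den : ℚ) ^ (2 * n) * Ring.choose c n = z := by
  obtain ⟨z, hz⟩ := factorial_dvd_pow_mul_prod c.num c.den n
  refine ⟨z, ?_⟩
  have h3 : (n.factorial : ℚ) ≠ 0 := by exact_mod_cast n.factorial_ne_zero
  have h := congrArg (Int.cast : ℤ → ℚ) hz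
  rw [Int.cast_mul, ← factorial_mul_choose] at h
  push_cast at h
  apply mul_left_cancel₀ h3
  rw [← h]
  ring

theorem coeff_binomialSeries (c : ℚ) (n : ℕ) :
    PowerSeries.coeff n (PowerSeries.binomialSeries Qbar c) = ((Ring.choose c n : ℚ) : Qbar) := by
  rw [PowerSeries.binomialSeries_coeff, Algebra.smul_def, mul_one, eq_ratCast]

/-- The series satisfies (1 + X) g' = c g. -/
theorem isDFinite_binomialSeries (c : ℚ) : IsDFinite (PowerSeries.binomialSeries Qbar c) := by
  refine IsDFinite.of_first_order (q := 1 + Polynomial.X) (r := Polynomial.C (-(c : Qbar)))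
    (fun h => by simpa using congrArg (Polynomial.eval 0) h) ?_
  convert isDFinite_polynomial (0 : Qbar[X]) using 1
  rw [Polynomial.coe_zero]
  ext1 n
  have h := congrArg (Rat.cast : ℚ → Qbar) (succ_mul_choose c n)
  push_cast at h
  rw [polynomial_smul_def, polynomial_smul_def, map_add, Polynomial.coe_add, Polynomial.coe_one,
    Polynomial.coe_X, Polynomial.coe_C, PowerSeries.coeff_C_mul, add_mul, one_mul, map_add,
    PowerSeries.coeff_derivative, coeff_binomialSeries, coeff_binomialSeries, map_zero]
  cases n with
  | zero =>
    rw [PowerSeries.coeff_zero_X_mul]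
    push_cast at h ⊢
    linear_combination h
  | succ n =>
    rw [PowerSeries.coeff_succ_X_mul, PowerSeries.coeff_derivative, coeff_binomialSeries]
    push_cast at h ⊢
    linear_combination h

theorem isGFunction_binomialSeries (c : ℚ) :
    IsGFunction (PowerSeries.binomialSeries Qbar c) := by
  refine isGFunction_iff.2 ⟨?_, ?_, isDFinite_binomialSeries c⟩
  · refine sizeBounded_of_le (A := 1) (B := 1 + |(c : ℝ)|) zero_le_one (by positivity) fun n σ => ?_
    rw [coeff_binomialSeries, map_ratCast, one_mul, Complex.norm_ratCast]
    exact_mod_cast abs_choose_le c n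
  · refine denomBounded_of_le (A := 1) (B := c.den ^ 2) zero_le_one (by positivity)
      (fun n => c.den ^ (2 * n))
      (fun n => pow_ne_zero _ (by exact_mod_cast c.den_ne_zero)) (fun n => ?_) fun n m hm => ?_
    · rw [one_mul, ← pow_mul]
      push_cast
      rw [abs_pow, Nat.abs_cast]
    · obtain ⟨z, hz⟩ := exists_int_eq_pow_mul_choose c m
      rw [coeff_binomialSeries]
      obtain ⟨j, rfl⟩ : ∃ j, n = j + m := ⟨n - m, by omega⟩
      have : ((c.den ^ (2 * (j + m)) : ℤ) : Qbar) * ((Ring.choose c m : ℚ) : Qbar) =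
          algebraMap ℤ Qbar (c.den ^ (2 * j) * z) := by
        have hz' := congrArg (Rat.cast : ℚ → Qbar) hz
        push_cast at hz'
        rw [eq_intCast]
        push_cast
        rw [← hz']
        ring
      rw [this]
      exact isIntegral_algebraMap

end GSeries

/-! ### Perturbation of paths and polynomial approximation -/

namespace GSeries

open scoped Polynomial PowerSeries unitInterval

section Perturbation

variable {γ : I → ℂ} {F : I → ℂ → ℂ}

/-- Germs along a path induce germs along all nearby paths. -/
theorem exists_nearby_continuation (hγ : Continuous γ) (han : ∀ t, AnalyticAt ℂ (F t) (γ t))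
    (hF : ∀ t, ∀ᶠ u in 𝓝 t, F u =ᶠ[𝓝 (γ u)] F t) :
    ∃ ε > 0, ∃ G : I → ℂ → ℂ, ∀ η : I → ℂ, (∀ t, dist (η t) (γ t) < ε) →
      (∀ t, AnalyticAt ℂ (G t) (η t)) ∧ (∀ t, ∀ᶠ u in 𝓝 t, G u =ᶠ[𝓝 (η u)] G t) ∧
      ∀ t, G t =ᶠ[𝓝 (γ t)] F t := by
  -- The radius 2r leaves room: γ u will be within r of the centre, and η u within ε ≤ r of γ u.
  have h1 : ∀ c, ∃ r > 0, AnalyticOnNhd ℂ (F c) (Metric.ball (γ c) (2 * r)) := by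
    intro c
    obtain ⟨r, hr, h⟩ := Metric.eventually_nhds_iff_ball.1 (han c).eventually_analyticAt
    exact ⟨r / 2, by positivity, fun z hz => h z (by rwa [mul_div_cancel₀ _ two_ne_zero] at hz)⟩
  choose r hr hball using h1
  let V : I → Set I := fun c =>
    interior {u | dist (γ u) (γ c) < r c ∧ F u =ᶠ[𝓝 (γ u)] F c}
  have hV : ∀ c, c ∈ V c := fun c => mem_interior_iff_mem_nhds.2
    ((hγ.continuousAt.eventually (Metric.ball_mem_nhds _ (hr c))).and (hF c))
  obtain ⟨T, hT⟩ := isCompact_univ.elim_finite_subcover V (fun _ => isOpen_interior)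
    fun u _ => Set.mem_iUnion.2 ⟨u, hV u⟩
  have h2 : ∀ u, ∃ c ∈ T, u ∈ V c := fun u => by simpa using hT (Set.mem_univ u)
  choose c hcT hcV using h2
  obtain ⟨ε, hε, hεT⟩ : ∃ ε > 0, ∀ c ∈ T, ε ≤ r c := by
    have hne : T.Nonempty := ⟨c 0, hcT 0⟩
    obtain ⟨m, -, hm⟩ := T.exists_min_image r hne
    exact ⟨r m, hr m, hm⟩
  -- The new family uses only finitely many germs, chosen from the cover independently of η.
  refine ⟨ε, hε, fun u => F (c u), fun η hη => ?_⟩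
  have hγmem : ∀ u d, u ∈ V d → γ u ∈ Metric.ball (γ d) (2 * r d) := fun u d hu => by
    have h3 : dist (γ u) (γ d) < r d := (interior_subset hu).1
    have := hr d
    rw [Metric.mem_ball]
    linarith
  have hηmem : ∀ u d, d ∈ T → u ∈ V d → η u ∈ Metric.ball (γ d) (2 * r d) := fun u d hd hu => by
    have h3 : dist (γ u) (γ d) < r d := (interior_subset hu).1
    have h4 := dist_triangle (η u) (γ u) (γ d)
    have h5 := hη u
    have h6 := hεT d hd
    rw [Metric.mem_ball]
    linarith
  refine ⟨fun t => hball _ _ (hηmem t _ (hcT t) (hcV t)), fun t => ?_, fun t => ?_⟩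
  · filter_upwards [isOpen_interior.mem_nhds (hcV t)] with u hu
    have h3 : F (c u) =ᶠ[𝓝 (γ u)] F (c t) :=
      (interior_subset (hcV u)).2.symm.trans (interior_subset hu).2
    set B := Metric.ball (γ (c u)) (2 * r (c u)) ∩ Metric.ball (γ (c t)) (2 * r (c t)) with hB
    have hconv : Convex ℝ B := (convex_ball _ _).inter (convex_ball _ _)
    -- The identity theorem on the convex set B carries the equality of germs from γ u over to η u.
    have heq : Set.EqOn (F (c u)) (F (c t)) B :=
      ((hball (c u)).mono Set.inter_subset_left).eqOn_of_preconnected_of_eventuallyEq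
        ((hball (c t)).mono Set.inter_subset_right) hconv.isPreconnected
        ⟨hγmem u _ (hcV u), hγmem u _ hu⟩ h3
    exact heq.eventuallyEq_of_mem ((Metric.isOpen_ball.inter Metric.isOpen_ball).mem_nhds
      ⟨hηmem u _ (hcT u) (hcV u), hηmem u _ (hcT t) hu⟩)
  · exact (interior_subset (hcV t)).2.symm

end Perturbation

theorem mem_Qbar_iff {z : ℂ} : z ∈ Qbar ↔ IsAlgebraic ℚ z :=
  mem_algebraicClosure_iff

theorem exists_algebraic_near (z : ℂ) {ε : ℝ} (hε : 0 < ε) : ∃ a : Qbar, dist (a : ℂ) z < ε := by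
  obtain ⟨x, hx1, hx2⟩ := exists_rat_btwn (show z.re < z.re + ε / 2 by linarith)
  obtain ⟨y, hy1, hy2⟩ := exists_rat_btwn (show z.im < z.im + ε / 2 by linarith)
  have hI : IsAlgebraic ℚ Complex.I := by
    refine ⟨Polynomial.X ^ 2 + 1, ?_, by simp⟩
    exact (Polynomial.monic_X_pow_add_C (1 : ℚ) two_ne_zero).ne_zero
  refine ⟨(x : Qbar) + (y : Qbar) * ⟨Complex.I, mem_Qbar_iff.2 hI⟩, ?_⟩
  have : (((x : Qbar) + (y : Qbar) * ⟨Complex.I, mem_Qbar_iff.2 hI⟩ : Qbar) : ℂ) - z =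
      ((x - z.re : ℝ) : ℂ) + ((y - z.im : ℝ) : ℂ) * Complex.I := by
    conv_lhs => rw [← Complex.re_add_im z]
    push_cast
    ring
  rw [dist_eq_norm, this]
  refine (norm_add_le _ _).trans_lt ?_
  rw [norm_mul, Complex.norm_I, mul_one, Complex.norm_real, Complex.norm_real,
    Real.norm_of_nonneg (by linarith), Real.norm_of_nonneg (by linarith)]
  linarith

/-- A path from `0` to an algebraic number is uniformly approximated by polynomials with algebraic
coefficients and the same end points. -/
theorem exists_polynomial_near_path {α : ℂ} (hα : IsAlgebraic ℚ α) (γ : Path (0 : ℂ) α) {ε : ℝ}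
    (hε : 0 < ε) : ∃ φ : Qbar[X], φ.coeff 0 = 0 ∧ Polynomial.aeval (1 : ℂ) φ = α ∧
      ∀ t : I, dist (Polynomial.aeval ((t : ℝ) : ℂ) φ) (γ t) < ε := by
  have hlim := bernsteinApproximation_uniform (γ : C(I, ℂ))
  obtain ⟨n, hn, hn0⟩ := ((hlim.eventually (Metric.ball_mem_nhds _ (half_pos hε))).and
    (eventually_ne_atTop 0)).exists
  -- In the Bernstein approximation the node values of γ are replaced by algebraic numbers, exact at
  -- both ends. The basis is a partition of unity, so this costs at most ε / 2.
  have h1 : ∀ k : Fin (n + 1), ∃ a : Qbar, dist (a : ℂ) (γ (bernstein.z k)) < ε / 2 ∧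
      (k = 0 → a = 0) ∧ (k = Fin.last n → (a : ℂ) = α) := by
    intro k
    by_cases hk0 : k = 0
    · subst hk0
      refine ⟨0, ?_, fun _ => rfl, fun h => absurd (congrArg Fin.val h) (by simpa using hn0.symm)⟩
      rw [bernstein.z_zero, γ.source]
      simpa using hε
    by_cases hk1 : k = Fin.last n
    · subst hk1
      refine ⟨⟨α, mem_Qbar_iff.2 hα⟩, ?_, fun h => absurd h hk0, fun _ => rfl⟩
      rw [bernstein.z_last hn0, γ.target]
      simpa using hε
    · obtain ⟨a, ha⟩ := exists_algebraic_near (γ (bernstein.z k)) (half_pos hε)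
      exact ⟨a, ha, fun h => absurd h hk0, fun h => absurd h hk1⟩
  choose a ha ha0 ha1 using h1
  have hev : ∀ x : Qbar, Polynomial.eval x
      (∑ k : Fin (n + 1), Polynomial.C (a k) * bernsteinPolynomial Qbar n k) =
      ∑ k : Fin (n + 1), a k * Polynomial.eval x (bernsteinPolynomial Qbar n k) := fun x => by
    rw [Polynomial.eval_finsetSum]
    simp only [Polynomial.eval_mul, Polynomial.eval_C]
  refine ⟨∑ k : Fin (n + 1), Polynomial.C (a k) * bernsteinPolynomial Qbar n k, ?_, ?_, ?_⟩
  · rw [Polynomial.coeff_zero_eq_eval_zero, hev]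
    refine Finset.sum_eq_zero fun k _ => ?_
    rw [bernsteinPolynomial.eval_at_0]
    split_ifs with h
    · rw [ha0 k (Fin.ext (by simpa using h)), zero_mul]
    · rw [mul_zero]
  · have h2 : Polynomial.aeval (algebraMap Qbar ℂ 1)
        (∑ k : Fin (n + 1), Polynomial.C (a k) * bernsteinPolynomial Qbar n k) = α := by
      rw [Polynomial.aeval_algebraMap_apply, Polynomial.coe_aeval_eq_eval, hev,
        Finset.sum_eq_single (Fin.last n)]
      · rw [bernsteinPolynomial.eval_at_1, if_pos (by simp), mul_one]
        exact ha1 _ rfl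
      · intro k _ hk
        rw [bernsteinPolynomial.eval_at_1, if_neg, mul_zero]
        intro h
        exact hk (Fin.ext (by simpa using h))
      · simp
    rwa [map_one] at h2
  · intro t
    have h3 : Polynomial.aeval ((t : ℝ) : ℂ)
        (∑ k : Fin (n + 1), Polynomial.C (a k) * bernsteinPolynomial Qbar n k) =
        ∑ k : Fin (n + 1), bernstein n k t • (a k : ℂ) := by
      rw [map_sum]
      refine Finset.sum_congr rfl fun k _ => ?_
      rw [map_mul, Polynomial.aeval_C, bernstein_apply, bernsteinPolynomial, Complex.real_smul]
      simp only [map_mul, map_natCast, map_pow, Polynomial.aeval_X, map_sub, map_one]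
      push_cast
      rw [mul_comm]
      rfl
    have h4 : dist (bernsteinApproximation n (γ : C(I, ℂ)) t) (γ t) < ε / 2 :=
      (ContinuousMap.dist_apply_le_dist t).trans_lt hn
    have h5 : dist (∑ k : Fin (n + 1), bernstein n k t • (a k : ℂ))
        (bernsteinApproximation n (γ : C(I, ℂ)) t) ≤ ε / 2 := by
      rw [bernsteinApproximation.apply, dist_eq_norm, ← Finset.sum_sub_distrib]
      calc _ ≤ ∑ k : Fin (n + 1), bernstein n k t * (ε / 2) := by
            refine norm_sum_le_of_le _ fun k _ => ?_
            rw [← smul_sub, norm_smul, Real.norm_of_nonneg bernstein_nonneg, ← dist_eq_norm]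
            exact mul_le_mul_of_nonneg_left (ha k).le bernstein_nonneg
        _ = ε / 2 := by rw [← Finset.sum_mul, bernstein.probability, one_mul]
    rw [h3]
    linarith [dist_triangle (∑ k : Fin (n + 1), bernstein n k t • (a k : ℂ))
      (bernsteinApproximation n (γ : C(I, ℂ)) t) (γ t)]

/-! ### Sums of convergent power series and substitution -/

/-- The power series `f` converges at `z`, with sum `h`. -/
def SumsTo (f : PowerSeries Qbar) (z h : ℂ) : Prop :=
  HasSum (fun n : ℕ => ((PowerSeries.coeff n f : Qbar) : ℂ) * z ^ n) h

theorem SumsTo.add {f g : PowerSeries Qbar} {z h k : ℂ} (hf : SumsTo f z h) (hg : SumsTo g z k) :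
    SumsTo (f + g) z (h + k) := by
  unfold SumsTo at *
  convert hf.add hg using 2 with n
  rw [map_add]
  push_cast
  ring

theorem SumsTo.mul {f g : PowerSeries Qbar} {z h k : ℂ} (hf : SumsTo f z h) (hg : SumsTo g z k) :
    SumsTo (f * g) z (h * k) := by
  unfold SumsTo at *
  have h1 := hf.summable.norm
  have h2 := hg.summable.norm
  have h3 := (summable_norm_sum_mul_antidiagonal_of_summable_norm h1 h2).of_norm.hasSum
  rw [← tsum_mul_tsum_eq_tsum_sum_antidiagonal_of_summable_norm h1 h2, hf.tsum_eq, hg.tsum_eq] at h3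
  have h4 : ∀ n, ((PowerSeries.coeff n (f * g) : Qbar) : ℂ) * z ^ n =
      ∑ p ∈ Finset.HasAntidiagonal.antidiagonal n, ((PowerSeries.coeff p.1 f : Qbar) : ℂ) *
        z ^ p.1 * (((PowerSeries.coeff p.2 g : Qbar) : ℂ) * z ^ p.2) := fun n => by
    rw [PowerSeries.coeff_mul]
    push_cast
    rw [Finset.sum_mul]
    refine Finset.sum_congr rfl fun p hp => ?_
    rw [← Finset.HasAntidiagonal.mem_antidiagonal.1 hp, pow_add]
    ring
  simpa only [h4] using h3

theorem hasSum_polynomial (φ : Qbar[X]) (z : ℂ) :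
    HasSum (fun n : ℕ => ((φ.coeff n : Qbar) : ℂ) * z ^ n) (Polynomial.aeval z φ) := by
  have h0 : ∀ n ∉ Finset.range (φ.natDegree + 1), ((φ.coeff n : Qbar) : ℂ) * z ^ n = 0 :=
    fun n hn => by
      rw [Polynomial.coeff_eq_zero_of_natDegree_lt (by simpa [Nat.lt_succ_iff] using hn)]
      simp
  have h1 := hasSum_sum_of_ne_finset_zero (L := .unconditional ℕ) h0
  rw [Polynomial.aeval_eq_sum_range]
  rwa [Finset.sum_congr rfl fun n _ => show _ = φ.coeff n • z ^ n by
    rw [Algebra.smul_def]; rfl] at h1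

theorem sumsTo_polynomial (φ : Qbar[X]) (z : ℂ) :
    SumsTo (φ : PowerSeries Qbar) z (Polynomial.aeval z φ) := by
  unfold SumsTo
  simpa only [Polynomial.coeff_coe] using hasSum_polynomial φ z

theorem SumsTo.of_norm_le {f : PowerSeries Qbar} {z w h : ℂ} (hf : SumsTo f z h)
    (hw : ‖w‖ ≤ ‖z‖) : Summable fun n : ℕ => ‖((PowerSeries.coeff n f : Qbar) : ℂ)‖ * ‖w‖ ^ n := by
  have h1 := hf.summable.norm
  refine h1.of_nonneg_of_le (fun n => by positivity) fun n => ?_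
  rw [norm_mul, norm_pow]
  gcongr

/-- The coefficientwise norm of a polynomial. -/
noncomputable def normPoly (φ : Qbar[X]) : Polynomial ℝ :=
  ∑ i ∈ φ.support, Polynomial.monomial i ‖((φ.coeff i : Qbar) : ℂ)‖

theorem coeff_normPoly (φ : Qbar[X]) (i : ℕ) :
    (normPoly φ).coeff i = ‖((φ.coeff i : Qbar) : ℂ)‖ := by
  rw [normPoly, Polynomial.finsetSum_coeff]
  simp only [Polynomial.coeff_monomial]
  rw [Finset.sum_ite_eq']
  split_ifs with h
  · rfl
  · rw [Polynomial.notMem_support_iff.1 h]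
    simp

theorem norm_coeff_pow_le_normPoly (φ : Qbar[X]) (d e : ℕ) :
    ‖(((φ ^ d).coeff e : Qbar) : ℂ)‖ ≤ ((normPoly φ) ^ d).coeff e := by
  induction d generalizing e with
  | zero =>
    rw [pow_zero, pow_zero, Polynomial.coeff_one, Polynomial.coeff_one]
    split_ifs <;> simp
  | succ d ih =>
    rw [pow_succ', pow_succ', Polynomial.coeff_mul, Polynomial.coeff_mul]
    push_cast
    refine norm_sum_le_of_le _ fun p _ => ?_
    rw [norm_mul, coeff_normPoly]
    exact mul_le_mul_of_nonneg_left (ih _) (norm_nonneg _)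

theorem sum_coeff_pow_le {φ : Qbar[X]} {x : ℝ} (hx : 0 ≤ x) (d : ℕ) (s : Finset ℕ) :
    ∑ e ∈ s, ‖(((φ ^ d).coeff e : Qbar) : ℂ)‖ * x ^ e ≤ ((normPoly φ).eval x) ^ d := by
  have hnn : ∀ e, 0 ≤ ((normPoly φ) ^ d).coeff e := fun e =>
    (norm_nonneg _).trans (norm_coeff_pow_le_normPoly φ d e)
  rw [← Polynomial.eval_pow, Polynomial.eval_eq_sum, Polynomial.sum]
  calc _ ≤ ∑ e ∈ s, ((normPoly φ) ^ d).coeff e * x ^ e :=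
        Finset.sum_le_sum fun e _ =>
          mul_le_mul_of_nonneg_right (norm_coeff_pow_le_normPoly φ d e) (by positivity)
    _ ≤ ∑ e ∈ s ∪ ((normPoly φ) ^ d).support, ((normPoly φ) ^ d).coeff e * x ^ e :=
        Finset.sum_le_sum_of_subset_of_nonneg Finset.subset_union_left
          fun e _ _ => mul_nonneg (hnn e) (by positivity)
    _ = ∑ e ∈ ((normPoly φ) ^ d).support, ((normPoly φ) ^ d).coeff e * x ^ e := by
        symm
        refine Finset.sum_subset Finset.subset_union_right fun e _ he => ?_
        rw [Polynomial.notMem_support_iff.1 he, zero_mul]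

/-- Interchange of summation in the double series of a_n (φ^n)_e z^e. Its absolute convergence
follows from `hs`, because the coefficients of φ^n are dominated by those of `normPoly φ ^ n`. -/
theorem SumsTo.subst {f : PowerSeries Qbar} {φ : Qbar[X]} (hφ : φ.coeff 0 = 0) {z h : ℂ}
    (hf : SumsTo f (Polynomial.aeval z φ) h)
    (hs : Summable fun n : ℕ =>
      ‖((PowerSeries.coeff n f : Qbar) : ℂ)‖ * ((normPoly φ).eval ‖z‖) ^ n) :
    SumsTo (f.subst (φ : PowerSeries Qbar)) z h := by
  let g : ℕ × ℕ → ℂ := fun p =>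
    ((PowerSeries.coeff p.1 f : Qbar) : ℂ) * ((((φ ^ p.1).coeff p.2 : Qbar) : ℂ) * z ^ p.2)
  have hbound : ∀ n : ℕ, ∀ s : Finset ℕ, ∑ e ∈ s, ‖g (n, e)‖ ≤
      ‖((PowerSeries.coeff n f : Qbar) : ℂ)‖ * ((normPoly φ).eval ‖z‖) ^ n := fun n s => by
    simp only [g, norm_mul, norm_pow]
    rw [← Finset.mul_sum]
    exact mul_le_mul_of_nonneg_left (sum_coeff_pow_le (norm_nonneg _) _ _) (norm_nonneg _)
  have hg : Summable g := by
    refine Summable.of_norm ((summable_prod_of_nonneg fun p => norm_nonneg _).2 ⟨fun n =>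
      summable_of_sum_le (fun _ => norm_nonneg _) (hbound n), ?_⟩)
    refine hs.of_nonneg_of_le (fun n => tsum_nonneg fun _ => norm_nonneg _) fun n => ?_
    exact (summable_of_sum_le (fun _ => norm_nonneg _) (hbound n)).tsum_le_of_sum_le (hbound n)
  have h1 : HasSum (fun n : ℕ => ((PowerSeries.coeff n f : Qbar) : ℂ) *
      (Polynomial.aeval z φ) ^ n) (∑' p, g p) := by
    have hfib : ∀ n, HasSum (fun e => g (n, e)) (((PowerSeries.coeff n f : Qbar) : ℂ) *
        (Polynomial.aeval z φ) ^ n) := fun n => by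
      have h2 := (hasSum_polynomial (φ ^ n) z).mul_left ((PowerSeries.coeff n f : Qbar) : ℂ)
      rwa [map_pow (Polynomial.aeval z) φ n] at h2
    exact hg.hasSum.prod_fiberwise hfib
  rw [hf.unique h1]
  have h2 := (Equiv.prodComm ℕ ℕ).hasSum_iff.2 hg.hasSum
  refine h2.prod_fiberwise fun e => ?_
  have h3 : ∀ d ∉ Finset.range (e + 1), (g ∘ (Equiv.prodComm ℕ ℕ)) (e, d) = 0 := fun d hd => by
    simp only [g, Function.comp_apply, Equiv.prodComm_apply, Prod.swap_prod_mk]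
    rw [coeff_pow_eq_zero_of_lt hφ (by simpa using hd)]
    simp
  have h4 := hasSum_sum_of_ne_finset_zero (L := .unconditional ℕ) h3
  rw [coeff_subst_polynomial hφ]
  push_cast
  rw [Finset.sum_mul]
  rwa [Finset.sum_congr rfl fun d _ => show _ = ((PowerSeries.coeff d f : Qbar) : ℂ) *
      (((φ ^ d).coeff e : Qbar) : ℂ) * z ^ e by
    simp only [g, Function.comp_apply, Equiv.prodComm_apply, Prod.swap_prod_mk]; ring] at h4

theorem eventually_sumsTo_subst {f : PowerSeries Qbar} {φ : Qbar[X]} (hφ : φ.coeff 0 = 0)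
    {h : ℂ → ℂ} (hf : ∀ᶠ z in 𝓝 (0 : ℂ), SumsTo f z (h z)) :
    ∀ᶠ z in 𝓝 (0 : ℂ), SumsTo (f.subst (φ : PowerSeries Qbar)) z (h (Polynomial.aeval z φ)) := by
  obtain ⟨r, hr, hr'⟩ := Metric.eventually_nhds_iff_ball.1 hf
  have hc1 : Tendsto (fun z : ℂ => Polynomial.aeval z φ) (𝓝 0) (𝓝 0) := by
    have := (Polynomial.continuous_aeval φ (A := ℂ)).tendsto 0
    rwa [show Polynomial.aeval (0 : ℂ) φ = 0 by
      rw [← Polynomial.coeff_zero_eq_aeval_zero', hφ, map_zero]] at this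
  have hc2 : Tendsto (fun z : ℂ => (normPoly φ).eval ‖z‖) (𝓝 0) (𝓝 0) := by
    have := ((normPoly φ).continuous.comp (continuous_norm (E := ℂ))).tendsto 0
    rwa [Function.comp_apply, norm_zero, ← Polynomial.coeff_zero_eq_eval_zero, coeff_normPoly, hφ,
      ZeroMemClass.coe_zero, norm_zero] at this
  have hw : SumsTo f ((r / 2 : ℝ) : ℂ) (h ((r / 2 : ℝ) : ℂ)) := hr' _ (by
    rw [mem_ball_zero_iff, Complex.norm_real, Real.norm_of_nonneg (by positivity)]
    linarith)
  filter_upwards [hc1.eventually (Metric.ball_mem_nhds _ hr),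
    hc2.eventually (Metric.ball_mem_nhds _ (half_pos hr))] with z hz1 hz2
  refine (hr' _ hz1).subst hφ ?_
  -- The bound with exponent 1 and an empty set of indices is exactly this nonnegativity.
  have hnn : 0 ≤ (normPoly φ).eval ‖z‖ := by
    simpa using (sum_coeff_pow_le (φ := φ) (norm_nonneg z) 1 ∅)
  have := hw.of_norm_le (w := (((normPoly φ).eval ‖z‖ : ℝ) : ℂ)) (by
    rw [dist_zero_right, Real.norm_of_nonneg hnn] at hz2
    rw [Complex.norm_real, Complex.norm_real, Real.norm_of_nonneg (by positivity : 0 ≤ r / 2),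
      Real.norm_of_nonneg hnn]
    exact hz2.le)
  simpa only [Complex.norm_real, Real.norm_of_nonneg hnn] using this

/-! ### The ring of values of G-functions -/

/-- The path from `0` to `1` along the real axis. -/
noncomputable def unitPath : Path (0 : ℂ) 1 where
  toFun t := ((t : ℝ) : ℂ)
  continuous_toFun := by fun_prop
  source' := by simp
  target' := by simp

/-- Moving the path to a polynomial one φ and pulling back by φ trades (f, α, γ) for (f ∘ φ, 1, [0,
1]). With one path for all values, germs can be added and multiplied pointwise. -/
theorem mem_gValues_iff_unitPath {v : ℂ} : v ∈ gValues ↔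
    ∃ f : PowerSeries Qbar, IsGFunction f ∧ ∃ F : I → ℂ → ℂ,
      IsContinuationAlong f unitPath F ∧ F 1 1 = v := by
  constructor
  · rintro ⟨f, hf, α, hα, γ, F, hF, rfl⟩
    obtain ⟨ε, hε, G, hG⟩ := exists_nearby_continuation γ.continuous hF.analytic hF.compat
    obtain ⟨φ, hφ0, hφ1, hφ⟩ := exists_polynomial_near_path hα γ hε
    obtain ⟨h1, h2, h3⟩ := hG _ hφ
    refine ⟨f.subst (φ : PowerSeries Qbar), hf.subst hφ0,
      fun t z => G t (Polynomial.aeval z φ), ⟨?_, fun t => ?_, fun t => ?_⟩, ?_⟩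
    · refine eventually_sumsTo_subst hφ0 ?_
      have h4 := h3 0
      rw [γ.source] at h4
      filter_upwards [h4, hF.start] with z hz1 hz2
      rw [hz1]
      exact hz2
    · exact (h1 t).fun_comp (f := fun z => Polynomial.aeval z φ)
        (AnalyticAt.aeval_polynomial analyticAt_id φ)
    · filter_upwards [h2 t] with u hu
      exact ((Polynomial.continuous_aeval φ (A := ℂ)).tendsto _).eventually hu
    · have h4 := (h3 1).self_of_nhds
      rw [γ.target] at h4
      beta_reduce
      rw [hφ1, h4]
  · rintro ⟨f, hf, F, hF, rfl⟩
    exact ⟨f, hf, 1, isAlgebraic_one, unitPath, F, hF, rfl⟩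

theorem add_mem_gValues {v w : ℂ} (hv : v ∈ gValues) (hw : w ∈ gValues) : v + w ∈ gValues := by
  rw [mem_gValues_iff_unitPath] at *
  obtain ⟨f, hf, F, hF, rfl⟩ := hv
  obtain ⟨g, hg, G, hG, rfl⟩ := hw
  refine ⟨f + g, hf.add hg, fun t z => F t z + G t z, ⟨?_, fun t => ?_, fun t => ?_⟩, rfl⟩
  · filter_upwards [hF.start, hG.start] with z h1 h2 using SumsTo.add h1 h2
  · exact (hF.analytic t).add (hG.analytic t)
  · filter_upwards [hF.compat t, hG.compat t] with u h1 h2 using h1.add h2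

theorem mul_mem_gValues {v w : ℂ} (hv : v ∈ gValues) (hw : w ∈ gValues) : v * w ∈ gValues := by
  rw [mem_gValues_iff_unitPath] at *
  obtain ⟨f, hf, F, hF, rfl⟩ := hv
  obtain ⟨g, hg, G, hG, rfl⟩ := hw
  refine ⟨f * g, hf.mul hg, fun t z => F t z * G t z, ⟨?_, fun t => ?_, fun t => ?_⟩, rfl⟩
  · filter_upwards [hF.start, hG.start] with z h1 h2 using SumsTo.mul h1 h2
  · exact (hF.analytic t).mul (hG.analytic t)
  · filter_upwards [hF.compat t, hG.compat t] with u h1 h2 using h1.mul h2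

theorem hasFPowerSeriesOnBall_of_sumsTo {f : PowerSeries Qbar} {h : ℂ → ℂ}
    (hf : ∀ z, ‖z‖ < 1 → SumsTo f z (h z)) :
    HasFPowerSeriesOnBall h (FormalMultilinearSeries.ofScalars ℂ
      fun n => ((PowerSeries.coeff n f : Qbar) : ℂ)) 0 1 where
  r_le := by
    refine ENNReal.le_of_forall_nnreal_lt fun r hr => ?_
    have hr1 : (r : ℝ) < 1 := by exact_mod_cast hr
    refine FormalMultilinearSeries.le_radius_of_summable_norm _ ?_
    have h1 := hf ((r : ℝ) : ℂ) (by simpa using hr1)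
    have h2 := h1.of_norm_le le_rfl
    simpa [FormalMultilinearSeries.ofScalars_norm] using h2
  r_pos := one_pos
  hasSum := by
    intro y hy
    have hy1 : ‖y‖ < 1 := by
      rw [← ENNReal.ofReal_one, Metric.eball_ofReal] at hy
      simpa using hy
    have h1 := hf y hy1
    rw [zero_add]
    unfold SumsTo at h1
    simpa [FormalMultilinearSeries.ofScalars_apply_eq, mul_comm] using h1

theorem mem_gValues_of_sumsTo {f : PowerSeries Qbar} (hf : IsGFunction f) {h : ℂ → ℂ}
    (hh : ∀ z, ‖z‖ < 1 → SumsTo f z (h z)) {α : ℂ} (hα : IsAlgebraic ℚ α) (hα1 : ‖α‖ < 1) :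
    h α ∈ gValues := by
  let γ : Path (0 : ℂ) α :=
    { toFun := fun t => ((t : ℝ) : ℂ) * α
      continuous_toFun := by fun_prop
      source' := by simp
      target' := by simp }
  refine ⟨f, hf, α, hα, γ, fun _ => h, ⟨?_, fun t => ?_, fun t => ?_⟩, rfl⟩
  · filter_upwards [Metric.ball_mem_nhds (0 : ℂ) one_pos] with z hz
    exact hh z (by simpa using hz)
  · refine (hasFPowerSeriesOnBall_of_sumsTo hh).analyticOnNhd _ ?_
    rw [← ENNReal.ofReal_one, Metric.eball_ofReal, mem_ball_zero_iff]
    change ‖((t : ℝ) : ℂ) * α‖ < 1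
    rw [norm_mul, Complex.norm_real, Real.norm_of_nonneg t.2.1]
    exact (mul_le_of_le_one_left (norm_nonneg _) t.2.2).trans_lt hα1
  · exact Eventually.of_forall fun _ => EventuallyEq.rfl

theorem mem_gValues_of_isAlgebraic {a : ℂ} (ha : IsAlgebraic ℚ a) : a ∈ gValues := by
  have := mem_gValues_of_sumsTo (isGFunction_polynomial (Polynomial.C (⟨a, mem_Qbar_iff.2 ha⟩ : Qbar)))
    (fun z _ => sumsTo_polynomial _ z) (isAlgebraic_zero (R := ℚ) (A := ℂ)) (by simp)
  rw [Polynomial.aeval_C] at this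
  exact this

/-- The ring of values of `G`-functions. -/
def gRing : Subring ℂ where
  carrier := gValues
  mul_mem' := mul_mem_gValues
  one_mem' := mem_gValues_of_isAlgebraic isAlgebraic_one
  add_mem' := add_mem_gValues
  zero_mem' := mem_gValues_of_isAlgebraic isAlgebraic_zero
  neg_mem' := fun {x} hx => by
    rw [← neg_one_mul]
    exact mul_mem_gValues (mem_gValues_of_isAlgebraic isAlgebraic_one.neg) hx

end GSeries

/-! ### Sums of G-functions on the unit disc -/

namespace GSeries

open scoped Polynomial PowerSeries
open MeasureTheory Set Asymptotics

theorem hasSum_of_forall_eq {f g : ℕ → ℂ} {a : ℂ} (h : HasSum f a) (hfg : ∀ n, g n = f n) :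
    HasSum g a := by
  rwa [funext hfg]

/-- Functions on the unit disc which are sums of `G`-functions. -/
def IsGSum (h : ℂ → ℂ) : Prop :=
  ∃ f, IsGFunction f ∧ ∀ z, ‖z‖ < 1 → SumsTo f z (h z)

theorem IsGSum.mul {h k : ℂ → ℂ} (hh : IsGSum h) (hk : IsGSum k) : IsGSum fun z => h z * k z := by
  obtain ⟨f, hf, hfh⟩ := hh
  obtain ⟨g, hg, hgk⟩ := hk
  exact ⟨f * g, hf.mul hg, fun z hz => (hfh z hz).mul (hgk z hz)⟩

theorem isGSum_polynomial (φ : Qbar[X]) : IsGSum fun z => Polynomial.aeval z φ :=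
  ⟨φ, isGFunction_polynomial φ, fun z _ => sumsTo_polynomial φ z⟩

theorem isGSum_one : IsGSum fun _ => 1 := by
  simpa using isGSum_polynomial 1

theorem IsGSum.pow {h : ℂ → ℂ} (hh : IsGSum h) (n : ℕ) : IsGSum fun z => h z ^ n := by
  induction n with
  | zero => simpa using isGSum_one
  | succ n ih => simpa only [pow_succ] using ih.mul hh

theorem IsGSum.mem_gRing {h : ℂ → ℂ} (hh : IsGSum h) {α : ℂ} (hα : IsAlgebraic ℚ α)
    (hα1 : ‖α‖ < 1) : h α ∈ gRing := by
  obtain ⟨f, hf, hfh⟩ := hh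
  exact mem_gValues_of_sumsTo hf hfh hα hα1

theorem IsGSum.analyticAt {h : ℂ → ℂ} (hh : IsGSum h) {z : ℂ} (hz : ‖z‖ < 1) :
    AnalyticAt ℂ h z := by
  obtain ⟨f, hf, hfh⟩ := hh
  refine (hasFPowerSeriesOnBall_of_sumsTo hfh).analyticOnNhd _ ?_
  rw [← ENNReal.ofReal_one, Metric.eball_ofReal, mem_ball_zero_iff]
  exact hz

theorem IsGFunction.rescale {f : PowerSeries Qbar} (hf : IsGFunction f) (a : Qbar) :
    IsGFunction (PowerSeries.rescale a f) := by
  rw [PowerSeries.rescale_eq_subst]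
  have h := hf.subst (φ := Polynomial.C a * Polynomial.X) (by simp)
  rwa [Polynomial.coe_mul, Polynomial.coe_C, Polynomial.coe_X,
    ← PowerSeries.smul_eq_C_mul] at h

theorem isGFunction_geometric : IsGFunction (PowerSeries.mk fun _ => (1 : Qbar)) := by
  refine isGFunction_iff.2 ⟨?_, ?_, ?_⟩
  · exact sizeBounded_of_le zero_le_one zero_le_one fun n σ => by simp
  · exact denomBounded_of_le zero_le_one zero_le_one (fun _ => 1) (fun _ => one_ne_zero)
      (fun n => by simp) fun n m _ => by simpa using isIntegral_one
  · refine IsDFinite.of_first_order (q := 1 - Polynomial.X) (r := -1)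
      (fun h => by simpa using congrArg (Polynomial.eval 0) h) ?_
    convert isDFinite_polynomial (0 : Qbar[X]) using 1
    rw [Polynomial.coe_zero]
    ext1 n
    rw [polynomial_smul_def, neg_smul, one_smul, Polynomial.coe_sub, Polynomial.coe_one,
      Polynomial.coe_X, sub_mul, one_mul]
    cases n with
    | zero =>
      rw [map_add, map_sub, PowerSeries.coeff_zero_X_mul, PowerSeries.coeff_derivative]
      simp
    | succ n => simp [PowerSeries.coeff_derivative, PowerSeries.coeff_succ_X_mul]

/-- Here log(1 - z) = -z ∑ z^n / (n + 1), the inverse Euler operator with s = 1 applied to the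
geometric series. -/
theorem isGSum_log : IsGSum fun z => Complex.log (1 - z) := by
  refine ⟨((-Polynomial.X : Qbar[X]) : PowerSeries Qbar) * eulerInverse 1
    (PowerSeries.mk fun _ => (1 : Qbar)), (isGFunction_polynomial _).mul
    (isGFunction_geometric.eulerInverse fun m h => ?_), fun z hz => ?_⟩
  · have : (0 : ℚ) ≤ m := Nat.cast_nonneg m
    linarith
  · have h := (Complex.hasSum_taylorSeries_neg_log hz).neg
    rw [neg_neg] at h
    refine hasSum_of_forall_eq h fun n => ?_
    rw [Polynomial.coe_neg, Polynomial.coe_X, neg_mul, map_neg]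
    cases n with
    | zero => simp
    | succ n =>
      rw [PowerSeries.coeff_succ_X_mul, eulerInverse, PowerSeries.coeff_mk, PowerSeries.coeff_mk]
      push_cast
      field_simp

theorem isGSum_one_sub_cpow (c : ℚ) : IsGSum fun z => (1 - z) ^ (c : ℂ) := by
  refine ⟨_, (isGFunction_binomialSeries c).rescale (-1), fun z hz => ?_⟩
  have hz' : -z ∈ Metric.eball (0 : ℂ) 1 := by
    rw [← ENNReal.ofReal_one, Metric.eball_ofReal]
    simpa using hz
  have h := Complex.one_add_cpow_hasFPowerSeriesOnBall_zero (a := (c : ℂ)).hasSum hz'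
  rw [zero_add, ← sub_eq_add_neg] at h
  refine hasSum_of_forall_eq h fun n => ?_
  have h2 : ((Ring.choose c n : ℚ) : ℂ) = Ring.choose (c : ℂ) n :=
    Ring.map_choose (algebraMap ℚ ℂ) c n
  rw [PowerSeries.coeff_rescale, coeff_binomialSeries, binomialSeries_apply, ← h2]
  simp only [List.ofFn_const, List.prod_replicate, smul_eq_mul]
  push_cast
  rw [neg_pow z]
  ring

theorem SumsTo.mul_deriv {f : PowerSeries Qbar} {h : ℂ → ℂ}
    (hf : ∀ z, ‖z‖ < 1 → SumsTo f z (h z)) {z : ℂ} (hz : ‖z‖ < 1) :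
    HasSum (fun n : ℕ => (n : ℂ) * (((PowerSeries.coeff n f : Qbar) : ℂ) * z ^ n))
      (z * deriv h z) := by
  have h1 := hasFPowerSeriesOnBall_of_sumsTo hf
  have hz' : z ∈ Metric.eball (0 : ℂ) 1 := by
    rw [← ENNReal.ofReal_one, Metric.eball_ofReal]
    simpa using hz
  have h2 := h1.fderiv.hasSum hz'
  have h3 := h2.mapL (ContinuousLinearMap.apply ℂ ℂ z)
  rw [zero_add] at h3
  simp only [ContinuousLinearMap.apply_apply, FormalMultilinearSeries.derivSeries_apply_diag] at h3
  have h4 : fderiv ℂ h z z = z * deriv h z := by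
    rw [← fderiv_apply_one_eq_deriv, ← smul_eq_mul, ← map_smul, smul_eq_mul, mul_one]
  rw [h4] at h3
  refine (hasSum_nat_add_iff' 1).1 ?_
  simpa [FormalMultilinearSeries.ofScalars_apply_eq, mul_comm] using h3

/-- Convergence on the whole disc persists because |1/(n + a)| is at most the denominator of a. -/
theorem IsGSum.exists_eulerInverse {h : ℂ → ℂ} (hh : IsGSum h) {a : ℚ} (ha : a ∈ admissible) :
    ∃ H, IsGSum H ∧ ∀ z, ‖z‖ < 1 → z * deriv H z + a * H z = h z := by
  obtain ⟨f, hf, hfh⟩ := hh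
  have hs : ∀ z : ℂ, ‖z‖ < 1 → ∃ w, SumsTo (eulerInverse a f) z w := by
    intro z hz
    have h1 : Summable fun n : ℕ => ((PowerSeries.coeff n f : Qbar) : ℂ) * z ^ n :=
      (hfh z hz).summable
    refine ⟨_, Summable.hasSum (Summable.of_norm_bounded (g := fun n : ℕ =>
      a.den * ‖((PowerSeries.coeff n f : Qbar) : ℂ) * z ^ n‖) (h1.norm.mul_left _) fun n => ?_)⟩
    rw [eulerInverse, PowerSeries.coeff_mk]
    push_cast
    rw [mul_right_comm, norm_mul, mul_comm]
    refine mul_le_mul_of_nonneg_right ?_ (norm_nonneg _)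
    exact_mod_cast norm_inv_natCast_add_le ha n
  choose! H hH using hs
  refine ⟨H, ⟨_, hf.eulerInverse ha, hH⟩, fun z hz => ?_⟩
  have h1 := (SumsTo.mul_deriv hH hz).add ((hH z hz).mul_left (a : ℂ))
  refine h1.unique ?_
  refine hasSum_of_forall_eq (hfh z hz) fun n => ?_
  have h0 : ((n : ℂ) + (a : ℂ)) ≠ 0 := by exact_mod_cast natCast_add_ne_zero ha n
  rw [eulerInverse, PowerSeries.coeff_mk]
  push_cast
  field_simp

/-! ### Mellin transforms and logarithmic factors -/

/-- Integrable functions on `(0, 1]` which are `O(t ^ (-ε))` at `0` for all `ε > 0`. -/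
structure LogGood (f : ℝ → ℂ) : Prop where
  locallyIntegrableOn : LocallyIntegrableOn f (Ioi 0)
  eq_zero : ∀ t, 1 < t → f t = 0
  isBigO : ∀ ε : ℝ, 0 < ε → f =O[𝓝[>] 0] fun t => t ^ (-ε)

theorem LogGood.log_smul {f : ℝ → ℂ} (hf : LogGood f) : LogGood fun t => Real.log t • f t where
  locallyIntegrableOn := hf.1.continuousOn_smul isOpen_Ioi.isLocallyClosed
    (Real.continuousOn_log.mono fun t ht => ne_of_gt ht)
  eq_zero t ht := by rw [hf.2 t ht, smul_zero]
  isBigO ε hε := by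
    have h1 := (isLittleO_log_rpow_nhdsGT_zero (r := -(ε / 2)) (by linarith)).isBigO.smul
      (hf.3 (ε / 2) (by linarith))
    refine h1.congr' EventuallyEq.rfl ?_
    filter_upwards [self_mem_nhdsWithin] with t ht
    rw [smul_eq_mul, ← Real.rpow_add ht]
    congr 1
    ring

theorem LogGood.log_pow_smul {f : ℝ → ℂ} (hf : LogGood f) (j : ℕ) :
    LogGood fun t => Real.log t ^ j • f t := by
  induction j with
  | zero => simpa using hf
  | succ j ih =>
    have h := ih.log_smul
    simpa only [smul_smul, ← pow_succ'] using h

theorem LogGood.hasDerivAt_mellin {f : ℝ → ℂ} (hf : LogGood f) {s : ℂ} (hs : 0 < s.re) :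
    HasDerivAt (mellin f) (mellin (fun t => Real.log t • f t) s) s := by
  -- Any exponents with 0 < b < Re s < a work: f vanishes beyond 1 and is O(t^(-b)) at 0.
  refine (mellin_hasDerivAt_of_isBigO_rpow (a := s.re + 1) (b := s.re / 2) hf.1 ?_ (by linarith)
    (hf.3 _ (by linarith)) (by linarith)).2
  refine (isBigO_zero (fun t : ℝ => t ^ (-(s.re + 1))) atTop).congr' ?_ EventuallyEq.rfl
  filter_upwards [eventually_gt_atTop 1] with t ht using (hf.2 t ht).symm

theorem LogGood.mellinConvergent {f : ℝ → ℂ} (hf : LogGood f) {s : ℂ} (hs : 0 < s.re) :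
    MellinConvergent f s := by
  refine mellinConvergent_of_isBigO_rpow (a := s.re + 1) (b := s.re / 2) hf.1 ?_ (by linarith)
    (hf.3 _ (by linarith)) (by linarith)
  refine (isBigO_zero (fun t : ℝ => t ^ (-(s.re + 1))) atTop).congr' ?_ EventuallyEq.rfl
  filter_upwards [eventually_gt_atTop 1] with t ht using (hf.2 t ht).symm

theorem LogGood.iteratedDeriv_mellin {f : ℝ → ℂ} (hf : LogGood f) (j : ℕ) {s : ℂ} (hs : 0 < s.re) :
    iteratedDeriv j (mellin f) s = mellin (fun t => Real.log t ^ j • f t) s := by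
  induction j generalizing s with
  | zero => simp
  | succ j ih =>
    rw [iteratedDeriv_succ]
    have h1 : iteratedDeriv j (mellin f) =ᶠ[𝓝 s] mellin (fun t => Real.log t ^ j • f t) := by
      filter_upwards [(isOpen_lt continuous_const Complex.continuous_re).mem_nhds hs] with z hz
        using ih hz
    rw [h1.deriv_eq, ((hf.log_pow_smul j).hasDerivAt_mellin hs).deriv]
    simp only [smul_smul, ← pow_succ']

theorem logGood_indicator {g : ℝ → ℂ} {c : ℝ} (hc0 : 0 < c) (hc : c ≤ 1)
    (hg : IntegrableOn g (Ioc 0 c)) (hg0 : ContinuousAt g 0) : LogGood ((Ioc 0 c).indicator g) where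
  locallyIntegrableOn :=
    ((integrable_indicator_iff measurableSet_Ioc).2 hg).locallyIntegrable.locallyIntegrableOn _
  eq_zero t ht := indicator_of_notMem (fun h => by linarith [h.2]) _
  isBigO ε hε := by
    have h1 : (Ioc 0 c).indicator g =O[𝓝[>] 0] fun _ => (1 : ℝ) := by
      have h2 : g =O[𝓝[>] 0] fun _ => (1 : ℝ) :=
        (hg0.tendsto.isBigO_one ℝ).mono nhdsWithin_le_nhds
      refine h2.congr' ?_ EventuallyEq.rfl
      filter_upwards [Ioc_mem_nhdsGT hc0] with t ht
      rw [indicator_of_mem ht]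
    refine h1.trans (IsBigO.of_bound 1 ?_)
    filter_upwards [Ioc_mem_nhdsGT (zero_lt_one' ℝ)] with t ht
    rw [one_mul, norm_one, Real.norm_of_nonneg (by have := ht.1; positivity)]
    exact Real.one_le_rpow_of_pos_of_le_one_of_nonpos ht.1 ht.2 (by linarith)

theorem mellin_indicator (g : ℝ → ℂ) {c : ℝ} (hc0 : 0 < c) (j : ℕ) (s : ℂ) :
    mellin (fun t => Real.log t ^ j • (Ioc 0 c).indicator g t) s =
      ∫ t in (0 : ℝ)..c, (t : ℂ) ^ (s - 1) * ((Real.log t : ℝ) : ℂ) ^ j * g t := by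
  rw [mellin, intervalIntegral.integral_of_le hc0.le]
  have h1 : ∀ t : ℝ, (t : ℂ) ^ (s - 1) • (Real.log t ^ j • (Ioc 0 c).indicator g t) =
      (Ioc 0 c).indicator
        (fun t => (t : ℂ) ^ (s - 1) * ((Real.log t : ℝ) : ℂ) ^ j * g t) t := fun t => by
    by_cases ht : t ∈ Ioc 0 c
    · rw [indicator_of_mem ht, indicator_of_mem ht, Complex.real_smul, smul_eq_mul]
      push_cast
      ring
    · rw [indicator_of_notMem ht, indicator_of_notMem ht, smul_zero, smul_zero]
  simp only [h1]
  rw [setIntegral_indicator measurableSet_Ioc, inter_eq_self_of_subset_right Ioc_subset_Ioi_self]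

theorem intervalIntegrable_of_logGood {g : ℝ → ℂ} {c : ℝ} (hc0 : 0 < c)
    (hg : LogGood ((Ioc 0 c).indicator g)) (j : ℕ) {s : ℂ} (hs : 0 < s.re) :
    IntervalIntegrable (fun t : ℝ => (t : ℂ) ^ (s - 1) * ((Real.log t : ℝ) : ℂ) ^ j * g t)
      volume 0 c := by
  rw [intervalIntegrable_iff_integrableOn_Ioc_of_le hc0.le]
  have h1 := ((hg.log_pow_smul j).mellinConvergent hs).mono_set (t := Ioi 0) (s := Ioc 0 c)
    Ioc_subset_Ioi_self
  refine h1.congr_fun (fun t ht => ?_) measurableSet_Ioc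
  beta_reduce
  rw [indicator_of_mem ht, Complex.real_smul, smul_eq_mul]
  push_cast
  ring

theorem IsGSum.continuousAt_ofReal {h : ℂ → ℂ} (hh : IsGSum h) {x : ℝ} (hx : |x| < 1) :
    ContinuousAt (fun t : ℝ => h t) x :=
  ContinuousAt.comp (f := fun t : ℝ => (t : ℂ))
    (hh.analyticAt (by simpa using hx)).continuousAt Complex.continuous_ofReal.continuousAt

theorem IsGSum.logGood_half {h : ℂ → ℂ} (hh : IsGSum h) :
    LogGood ((Ioc 0 (1 / 2)).indicator fun t : ℝ => h t) := by
  refine logGood_indicator (by norm_num) (by norm_num) ?_ (hh.continuousAt_ofReal (by simp))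
  refine (ContinuousOn.integrableOn_Icc (a := 0) (b := 1 / 2) fun x hx => ?_).mono_set
    Ioc_subset_Icc_self
  exact (hh.continuousAt_ofReal (abs_lt.2 ⟨by linarith [hx.1], by linarith [hx.2]⟩)).continuousWithinAt

/-- With b = a/(j+1), the function is (x^b log x)^j · x^b, and every factor except possibly a zeroth
power tends to 0. -/
theorem tendsto_cpow_mul_log_pow {a : ℝ} (ha : 0 < a) (j : ℕ) :
    Tendsto (fun x : ℝ => (x : ℂ) ^ (a : ℂ) * ((Real.log x : ℝ) : ℂ) ^ j) (𝓝[>] 0) (𝓝 0) := by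
  have hb : 0 < a / (j + 1) := by positivity
  have h1 := (tendsto_log_mul_rpow_nhdsGT_zero hb).pow j
  have h2 : Tendsto (fun x : ℝ => x ^ (a / (j + 1))) (𝓝[>] 0) (𝓝 0) := by
    have := (Real.continuousAt_rpow_const 0 (a / (j + 1)) (Or.inr hb.le)).tendsto
    rw [Real.zero_rpow hb.ne'] at this
    exact this.mono_left nhdsWithin_le_nhds
  have h3 := (Complex.continuous_ofReal.tendsto _).comp (h1.mul h2)
  rw [mul_zero, Complex.ofReal_zero] at h3
  refine h3.congr' ?_
  filter_upwards [self_mem_nhdsWithin] with x hx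
  have hx : 0 < x := hx
  rw [Function.comp_apply, ← Complex.ofReal_cpow hx.le, ← Complex.ofReal_pow,
    ← Complex.ofReal_mul, mul_pow, mul_assoc, ← pow_succ, ← Real.rpow_natCast (_ ^ _) (j + 1),
    ← Real.rpow_mul hx.le, mul_comm]
  congr 3
  push_cast
  field_simp

/-! ### Integrals over (0, 1/2) as values of G-functions -/

theorem isAlgebraic_cpow_rat {x : ℂ} (hx : IsAlgebraic ℚ x) (a : ℚ) :
    IsAlgebraic ℚ (x ^ (a : ℂ)) := by
  have h1 : (x ^ (a : ℂ)) ^ a.den = x ^ a.num := by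
    have : (a.den : ℂ) ≠ 0 := by exact_mod_cast a.den_ne_zero
    rw [← Complex.cpow_mul_nat, ← Complex.cpow_intCast]
    congr 1
    exact_mod_cast Rat.mul_den_eq_num a
  refine IsAlgebraic.of_pow a.den_pos ?_
  rw [h1]
  cases a.num with
  | ofNat n => simpa using hx.pow n
  | negSucc n => simpa using (hx.pow (n + 1)).inv

theorem log_half_mem_gRing : ((Real.log (1 / 2) : ℝ) : ℂ) ∈ gRing := by
  have h := isGSum_log.mem_gRing (α := 1 / 2) (by
    simpa using (isAlgebraic_algebraMap (R := ℚ) (A := ℂ) (1 / 2))) (by norm_num)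
  have h2 : Complex.log (1 - 1 / 2) = ((Real.log (1 / 2) : ℝ) : ℂ) := by
    rw [Complex.ofReal_log (by norm_num)]
    norm_num
  rwa [h2] at h

/-- The primitive is x^a log(x)^j H(x), since aH + xH' = h; it tends to 0 at 0 because a > 0.
Stopping at 1/2 keeps the boundary point inside the disc. For j = 0 the truncated exponent j - 1 is
harmless, its term having the factor j. -/
theorem IsGSum.integral_by_parts {h H : ℂ → ℂ} (hh : IsGSum h) (hH : IsGSum H) {a : ℚ}
    (ha : 0 < a) (hHh : ∀ z, ‖z‖ < 1 → z * deriv H z + a * H z = h z) (j : ℕ) :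
    (∫ x in (0 : ℝ)..(1 / 2), (x : ℂ) ^ ((a : ℂ) - 1) * ((Real.log x : ℝ) : ℂ) ^ j * h x) =
      ((1 / 2 : ℝ) : ℂ) ^ (a : ℂ) * ((Real.log (1 / 2) : ℝ) : ℂ) ^ j * H ((1 / 2 : ℝ) : ℂ) -
      j * ∫ x in (0 : ℝ)..(1 / 2),
        (x : ℂ) ^ ((a : ℂ) - 1) * ((Real.log x : ℝ) : ℂ) ^ (j - 1) * H x := by
  have hare : 0 < ((a : ℂ)).re := by simpa using ha
  have hi1 := intervalIntegrable_of_logGood (by norm_num) hh.logGood_half j hare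
  have hi2 := (intervalIntegrable_of_logGood (by norm_num) hH.logGood_half (j - 1)
    hare).const_mul (j : ℂ)
  have hcont := hH.continuousAt_ofReal (x := 1 / 2) (by norm_num [abs_lt])
  have hderiv : ∀ x ∈ Ioo (0 : ℝ) (1 / 2), HasDerivAt
      (fun x : ℝ => (x : ℂ) ^ (a : ℂ) * ((Real.log x : ℝ) : ℂ) ^ j * H x)
      ((x : ℂ) ^ ((a : ℂ) - 1) * ((Real.log x : ℝ) : ℂ) ^ j * h x +
        j * ((x : ℂ) ^ ((a : ℂ) - 1) * ((Real.log x : ℝ) : ℂ) ^ (j - 1) * H x)) x := by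
    intro x hx
    have hx0 : (x : ℂ) ≠ 0 := by exact_mod_cast hx.1.ne'
    have hx1 : ‖(x : ℂ)‖ < 1 := by
      rw [Complex.norm_real, Real.norm_of_nonneg hx.1.le]
      linarith [hx.2]
    have d1 := hasDerivAt_ofReal_cpow_const hx.1.ne' (r := (a : ℂ)) (by exact_mod_cast ha.ne')
    have d2 := ((Real.hasDerivAt_log hx.1.ne').ofReal_comp).fun_pow j
    have d3 := (hH.analyticAt hx1).differentiableAt.hasDerivAt.comp_ofReal
    refine ((d1.fun_mul d2).fun_mul d3).congr_deriv ?_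
    have e1 : (x : ℂ) ^ (a : ℂ) = (x : ℂ) ^ ((a : ℂ) - 1) * x := by
      rw [Complex.cpow_sub _ _ hx0, Complex.cpow_one, div_mul_cancel₀ _ hx0]
    rw [e1, ← hHh _ hx1]
    push_cast
    field_simp
    ring
  have h0 : Tendsto (fun x : ℝ => (x : ℂ) ^ (a : ℂ) * ((Real.log x : ℝ) : ℂ) ^ j * H x)
      (𝓝[>] 0) (𝓝 0) := by
    have e1 := tendsto_cpow_mul_log_pow (a := (a : ℝ)) (by exact_mod_cast ha) j
    rw [Complex.ofReal_ratCast] at e1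
    have e2 := (hH.continuousAt_ofReal (x := 0) (by simp)).tendsto.mono_left
      (nhdsWithin_le_nhds (s := Ioi 0))
    simpa using e1.mul e2
  have h1 : Tendsto (fun x : ℝ => (x : ℂ) ^ (a : ℂ) * ((Real.log x : ℝ) : ℂ) ^ j * H x)
      (𝓝[<] (1 / 2)) (𝓝 (((1 / 2 : ℝ) : ℂ) ^ (a : ℂ) * ((Real.log (1 / 2) : ℝ) : ℂ) ^ j *
        H ((1 / 2 : ℝ) : ℂ))) := by
    have c1 : ContinuousAt (fun x : ℝ => (x : ℂ) ^ (a : ℂ)) (1 / 2) :=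
      Complex.continuousAt_ofReal_cpow_const _ _ (Or.inr (by norm_num))
    have c2 : ContinuousAt (fun x : ℝ => ((Real.log x : ℝ) : ℂ) ^ j) (1 / 2) :=
      (Complex.continuous_ofReal.continuousAt.comp
        (Real.continuousAt_log (by norm_num))).pow j
    exact ((c1.mul c2).mul hcont).tendsto.mono_left nhdsWithin_le_nhds
  have h2 := intervalIntegral.integral_eq_sub_of_hasDerivAt_of_tendsto (by norm_num) hderiv
    (hi1.add hi2) h0 h1
  rw [intervalIntegral.integral_add hi1 hi2, intervalIntegral.integral_const_mul, sub_zero] at h2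
  exact eq_sub_of_add_eq h2

theorem admissible_of_pos {a : ℚ} (ha : 0 < a) : a ∈ admissible := fun m h => by
  have : (0 : ℚ) ≤ m := Nat.cast_nonneg m
  linarith

theorem isAlgebraic_half : IsAlgebraic ℚ ((1 / 2 : ℝ) : ℂ) := by
  simpa using (isAlgebraic_algebraMap (R := ℚ) (A := ℂ) (1 / 2))

theorem mem_gRing_of_isAlgebraic {x : ℂ} (hx : IsAlgebraic ℚ x) : x ∈ gRing :=
  mem_gValues_of_isAlgebraic hx

/-- Each integration by parts removes one logarithm and leaves a boundary term made of an algebraic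
number, a power of log(1/2) and the G-value H(1/2). -/
theorem IsGSum.integral_mem_gRing {h : ℂ → ℂ} (hh : IsGSum h) {a : ℚ} (ha : 0 < a) (j : ℕ) :
    ∫ x in (0 : ℝ)..(1 / 2), (x : ℂ) ^ ((a : ℂ) - 1) * ((Real.log x : ℝ) : ℂ) ^ j * h x ∈
      gRing := by
  induction j generalizing h with
  | zero =>
    obtain ⟨H, hH, hHh⟩ := hh.exists_eulerInverse (admissible_of_pos ha)
    rw [hh.integral_by_parts hH ha hHh, Nat.cast_zero, zero_mul, sub_zero]
    refine gRing.mul_mem (gRing.mul_mem ?_ (gRing.pow_mem log_half_mem_gRing _))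
      (hH.mem_gRing isAlgebraic_half (by norm_num))
    exact mem_gRing_of_isAlgebraic (isAlgebraic_cpow_rat isAlgebraic_half a)
  | succ j ih =>
    obtain ⟨H, hH, hHh⟩ := hh.exists_eulerInverse (admissible_of_pos ha)
    rw [hh.integral_by_parts hH ha hHh]
    refine gRing.sub_mem (gRing.mul_mem (gRing.mul_mem ?_ (gRing.pow_mem log_half_mem_gRing _))
      (hH.mem_gRing isAlgebraic_half (by norm_num))) (gRing.mul_mem (natCast_mem gRing _) (ih hH))
    exact mem_gRing_of_isAlgebraic (isAlgebraic_cpow_rat isAlgebraic_half a)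

end GSeries

/-! ### Beta integrals and the Mellin transform of log(1 - t) -/

namespace GSeries

open MeasureTheory Set

/-- Reflection moves the singularity at 1 to 0, so that both halves fall under
`IsGSum.integral_mem_gRing`. -/
theorem intervalIntegral_split_half {φ : ℝ → ℂ} (h : IntervalIntegrable φ volume 0 1) :
    ∫ x in (0 : ℝ)..1, φ x =
      (∫ x in (0 : ℝ)..(1 / 2), φ x) + ∫ x in (0 : ℝ)..(1 / 2), φ (1 - x) := by
  rw [intervalIntegral.integral_comp_sub_left, sub_zero,
    show (1 : ℝ) - 1 / 2 = 1 / 2 by norm_num, intervalIntegral.integral_add_adjacent_intervals]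
  · refine h.mono_set (uIcc_subset_uIcc left_mem_uIcc ?_)
    rw [uIcc_of_le zero_le_one]
    norm_num
  · refine h.mono_set (uIcc_subset_uIcc ?_ right_mem_uIcc)
    rw [uIcc_of_le zero_le_one]
    norm_num

theorem betaIntegral_mem_gRing {a b : ℚ} (ha : 0 < a) (hb : 0 < b) :
    Complex.betaIntegral a b ∈ gRing := by
  have hare : 0 < ((a : ℂ)).re := by simpa using ha
  have hbre : 0 < ((b : ℂ)).re := by simpa using hb
  rw [Complex.betaIntegral, intervalIntegral_split_half (Complex.betaIntegral_convergent hare hbre)]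
  refine gRing.add_mem ?_ ?_
  · have h := (isGSum_one_sub_cpow (b - 1)).integral_mem_gRing ha 0
    simpa using h
  · have h := (isGSum_one_sub_cpow (a - 1)).integral_mem_gRing hb 0
    simpa [mul_comm] using h

/-- The function `log (1 - t)` on `(0, 1]`. -/
noncomputable def logKernel : ℝ → ℂ := (Ioc 0 1).indicator fun t => Complex.log (1 - (t : ℂ))

theorem logGood_logKernel : LogGood logKernel := by
  refine logGood_indicator one_pos le_rfl ?_ ?_
  · have h1 : IntervalIntegrable (fun t : ℝ => Real.log (1 - t)) volume 0 1 := by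
      have := (intervalIntegral.intervalIntegrable_log' (a := 1) (b := 0)).comp_sub_left 1
      simpa using this
    rw [intervalIntegrable_iff_integrableOn_Ioc_of_le zero_le_one] at h1
    refine IntegrableOn.congr_fun h1.ofReal (fun t ht => ?_) measurableSet_Ioc
    have h2 : 0 ≤ 1 - t := by linarith [ht.2]
    change ((Real.log (1 - t) : ℝ) : ℂ) = _
    rw [Complex.ofReal_log h2]
    push_cast
    rfl
  · exact ContinuousAt.comp (f := fun t : ℝ => (1 - (t : ℂ))) (g := Complex.log)
      (continuousAt_clog (by simp)) (by fun_prop)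

theorem iteratedDeriv_mellin_logKernel_mem_gRing {s : ℚ} (hs : 0 < s) (j : ℕ) :
    iteratedDeriv j (mellin logKernel) s ∈ gRing := by
  have hre : 0 < ((s : ℂ)).re := by simpa using hs
  rw [logGood_logKernel.iteratedDeriv_mellin j hre, logKernel, mellin_indicator _ one_pos,
    intervalIntegral_split_half (intervalIntegrable_of_logGood one_pos logGood_logKernel j hre)]
  refine gRing.add_mem (isGSum_log.integral_mem_gRing hs j) ?_
  -- On the reflected half, log(1 - t) becomes the singular factor log x (hence a = 1 and one
  -- logarithm), and t^(s-1) log(t)^j becomes analytic in the disc.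
  have h := ((isGSum_one_sub_cpow (s - 1)).mul (isGSum_log.pow j)).integral_mem_gRing one_pos 1
  convert h using 1
  refine intervalIntegral.integral_congr fun x hx => ?_
  rw [uIcc_of_le (by norm_num)] at hx
  have h1 : ((Real.log (1 - x) : ℝ) : ℂ) = Complex.log (1 - x) := by
    rw [Complex.ofReal_log (by linarith [hx.2])]
    push_cast
    rfl
  have h2 : ((Real.log x : ℝ) : ℂ) = Complex.log x := Complex.ofReal_log hx.1
  rw [h1, h2]
  push_cast
  rw [sub_sub_cancel, sub_self, Complex.cpow_zero]
  ring

theorem mellin_beta {b s : ℂ} :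
    mellin ((Ioc 0 1).indicator fun t : ℝ => (1 - (t : ℂ)) ^ (s - 1)) b =
      Complex.betaIntegral b s := by
  have h := mellin_indicator (fun t : ℝ => (1 - (t : ℂ)) ^ (s - 1)) one_pos 0 b
  simpa [Complex.betaIntegral] using h

/-- As a function of b, the beta integral is the Mellin transform of (1-t)^(s-1). Its derivative at
1 inserts log t, and the reflection of t turns this into the transform of log(1-t) at s. -/
theorem hasDerivAt_betaIntegral {s : ℂ} (hs : 0 < s.re) :
    HasDerivAt (fun b => Complex.betaIntegral b s) (mellin logKernel s) 1 := by
  have hg : LogGood ((Ioc 0 1).indicator fun t : ℝ => (1 - (t : ℂ)) ^ (s - 1)) := by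
    refine logGood_indicator one_pos le_rfl ?_ ?_
    · have h := Complex.betaIntegral_convergent (u := 1) (by simp) hs
      rw [intervalIntegrable_iff_integrableOn_Ioc_of_le zero_le_one] at h
      simpa using h
    · exact ContinuousAt.cpow (by fun_prop) continuousAt_const (by simp)
  have h := hg.hasDerivAt_mellin (s := 1) (by simp)
  have h1 : mellin (fun t => Real.log t • (Ioc (0 : ℝ) 1).indicator
      (fun t : ℝ => (1 - (t : ℂ)) ^ (s - 1)) t) 1 = mellin logKernel s := by
    have e1 := mellin_indicator (fun t : ℝ => (1 - (t : ℂ)) ^ (s - 1)) one_pos 1 1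
    have e2 := mellin_indicator (fun t : ℝ => Complex.log (1 - (t : ℂ))) one_pos 0 s
    simp only [pow_one] at e1
    simp only [pow_zero, one_smul, mul_one] at e2
    rw [e1, logKernel]
    refine Eq.trans ?_ e2.symm
    have e3 := intervalIntegral.integral_comp_sub_left (a := 0) (b := 1)
      (fun t : ℝ => (t : ℂ) ^ (s - 1) * Complex.log (1 - (t : ℂ))) 1
    rw [sub_zero, sub_self] at e3
    rw [← e3]
    refine intervalIntegral.integral_congr fun x hx => ?_
    rw [uIcc_of_le zero_le_one] at hx
    rw [Complex.ofReal_log hx.1]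
    push_cast
    rw [sub_sub_cancel, sub_self, Complex.cpow_zero]
    ring
  rw [h1] at h
  rwa [show mellin _ = fun b => Complex.betaIntegral b s from funext fun b => mellin_beta] at h

/-! ### The digamma function at rational points -/

/-- Differentiate Γ(s)Γ(b) = Γ(b+s)B(b,s) at b = 1, using Γ'(1) = -γ and B(1,s) = 1/s. -/
theorem deriv_Gamma_add_one_eq {s : ℂ} (hs : 0 < s.re) :
    deriv Complex.Gamma (s + 1) = Complex.Gamma (s + 1) *
      (-(Real.eulerMascheroniConstant : ℂ) - s * mellin logKernel s) := by
  have hs0 : s ≠ 0 := fun h => by simp [h] at hs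
  have h1 : (fun b => Complex.Gamma s * Complex.Gamma b) =ᶠ[𝓝 1]
      fun b => Complex.Gamma (b + s) * Complex.betaIntegral b s := by
    filter_upwards [(isOpen_lt continuous_const Complex.continuous_re).mem_nhds
      (show (0 : ℝ) < (1 : ℂ).re by simp)] with b hb
    rw [mul_comm, Complex.Gamma_mul_Gamma_eq_betaIntegral hb hs]
  have hd1 : DifferentiableAt ℂ Complex.Gamma (1 + s) := by
    refine Complex.differentiableAt_Gamma _ fun m h => ?_
    have := congrArg Complex.re h
    simp only [Complex.add_re, Complex.one_re, Complex.neg_re, Complex.natCast_re] at this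
    have hm : (0 : ℝ) ≤ m := Nat.cast_nonneg m
    linarith
  have d1 := (Complex.hasDerivAt_Gamma_one.const_mul (Complex.Gamma s)).congr_of_eventuallyEq
    h1.symm
  have d2 := (hd1.hasDerivAt.comp_add_const 1 s).mul (hasDerivAt_betaIntegral hs)
  have h2 := d1.unique d2
  rw [← Complex.betaIntegral_symm, Complex.betaIntegral_eval_one_right hs, add_comm 1 s,
    Complex.Gamma_add_one s hs0] at h2
  rw [Complex.Gamma_add_one s hs0]
  field_simp at h2
  linear_combination -h2

theorem mellin_logKernel_analyticAt {s : ℂ} (hs : 0 < s.re) :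
    AnalyticAt ℂ (mellin logKernel) s := by
  refine DifferentiableOn.analyticAt (s := {z : ℂ | 0 < z.re}) (fun z hz =>
    (logGood_logKernel.hasDerivAt_mellin hz).differentiableAt.differentiableWithinAt) ?_
  exact (isOpen_lt continuous_const Complex.continuous_re).mem_nhds hs

/-- Γ is the inverse of the entire function 1/Γ, which is nonzero at s. -/
theorem Gamma_analyticAt {s : ℂ} (hs : ∀ m : ℕ, s ≠ -m) : AnalyticAt ℂ Complex.Gamma s := by
  have h1 : AnalyticAt ℂ (fun z => (Complex.Gamma z)⁻¹) s :=
    Complex.differentiable_one_div_Gamma.analyticAt s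
  have h2 := h1.fun_inv (inv_ne_zero (Complex.Gamma_ne_zero hs))
  simpa only [inv_inv] using h2

theorem cast_ne_neg_of_admissible {s : ℚ} (hs : s ∈ admissible) (m : ℕ) : (s : ℂ) ≠ -m := by
  exact_mod_cast hs m

theorem iteratedDeriv_id_mul {f : ℂ → ℂ} {s : ℂ} (hf : AnalyticAt ℂ f s) (n : ℕ) :
    iteratedDeriv n (fun z => z * f z) s =
      s * iteratedDeriv n f s + n * iteratedDeriv (n - 1) f s := by
  rw [iteratedDeriv_fun_mul contDiff_fun_id.contDiffAt hf.contDiffAt]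
  cases n with
  | zero => simp
  | succ n =>
    rw [Finset.sum_range_succ', Finset.sum_range_succ', Finset.sum_eq_zero]
    · simp [iteratedDeriv_fun_id]
      ring
    · intro i _
      simp [iteratedDeriv_fun_id]

/-- The digamma function on `Re s > 1`. -/
noncomputable def psi (z : ℂ) : ℂ :=
  -(Real.eulerMascheroniConstant : ℂ) - (z - 1) * mellin logKernel (z - 1)

theorem psi_analyticAt {s : ℂ} (hs : 1 < s.re) : AnalyticAt ℂ psi s := by
  have h1 : AnalyticAt ℂ (mellin logKernel) (s - 1) :=
    mellin_logKernel_analyticAt (by simpa using hs)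
  have h2 : AnalyticAt ℂ (fun z => mellin logKernel (z - 1)) s :=
    h1.fun_comp (f := fun z => z - 1) (analyticAt_id.sub analyticAt_const)
  exact analyticAt_const.sub ((analyticAt_id.sub analyticAt_const).mul h2)

theorem deriv_Gamma_eventuallyEq {s : ℂ} (hs : 1 < s.re) :
    deriv Complex.Gamma =ᶠ[𝓝 s] fun z => Complex.Gamma z * psi z := by
  filter_upwards [(isOpen_lt continuous_const Complex.continuous_re).mem_nhds hs] with z hz
  have h := deriv_Gamma_add_one_eq (s := z - 1) (by simpa using hz)
  rwa [sub_add_cancel] at h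

theorem iteratedDeriv_id_mul_mellin_mem_gRing {s : ℚ} (hs : 1 < s) (m : ℕ) :
    iteratedDeriv m (fun z => (z - 1) * mellin logKernel (z - 1)) s ∈ gRing := by
  have h := congrFun (iteratedDeriv_comp_sub_const m (fun z => z * mellin logKernel z) (1 : ℂ))
    (s : ℂ)
  have hpos : 0 < s - 1 := by linarith
  have hcast : (s : ℂ) - 1 = ((s - 1 : ℚ) : ℂ) := by push_cast; rfl
  rw [h, hcast, iteratedDeriv_id_mul (mellin_logKernel_analyticAt (by
    rw [Complex.ratCast_re]; exact_mod_cast hpos))]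
  refine gRing.add_mem (gRing.mul_mem (mem_gRing_of_isAlgebraic ?_)
    (iteratedDeriv_mellin_logKernel_mem_gRing hpos _)) (gRing.mul_mem (natCast_mem _ _)
    (iteratedDeriv_mellin_logKernel_mem_gRing hpos _))
  exact isAlgebraic_algebraMap (R := ℚ) (A := ℂ) (s - 1)

theorem psi_add_mem_gRing {s : ℚ} (hs : 1 < s) :
    psi s + (Real.eulerMascheroniConstant : ℂ) ∈ gRing := by
  have h := iteratedDeriv_id_mul_mellin_mem_gRing hs 0
  rw [iteratedDeriv_zero] at h
  convert gRing.neg_mem h using 1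
  rw [psi]
  ring

/-- The constant -γ disappears after one differentiation; γ therefore enters the expansions only
through `psi` itself. -/
theorem iteratedDeriv_psi_mem_gRing {s : ℚ} (hs : 1 < s) {m : ℕ} (hm : 0 < m) :
    iteratedDeriv m psi s ∈ gRing := by
  unfold psi
  rw [iteratedDeriv_const_sub hm, iteratedDeriv_neg]
  exact gRing.neg_mem (iteratedDeriv_id_mul_mellin_mem_gRing hs m)

/-! ### Expansion of the derivatives of Γ in powers of γ -/

/-- Polynomials in Euler's constant of degree less than `n`, with coefficients in `gRing`. -/
noncomputable def eulerPoly (n : ℕ) : Submodule gRing ℂ :=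
  Submodule.span gRing ((fun i => (Real.eulerMascheroniConstant : ℂ) ^ i) '' Set.Iio n)

theorem eulerPoly_mono {m n : ℕ} (h : m ≤ n) : eulerPoly m ≤ eulerPoly n :=
  Submodule.span_mono (image_mono (Iio_subset_Iio h))

theorem pow_mem_eulerPoly {i n : ℕ} (h : i < n) :
    (Real.eulerMascheroniConstant : ℂ) ^ i ∈ eulerPoly n :=
  Submodule.subset_span ⟨i, h, rfl⟩

theorem neg_pow_mem_eulerPoly {i n : ℕ} (h : i < n) :
    (-(Real.eulerMascheroniConstant : ℂ)) ^ i ∈ eulerPoly n := by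
  rw [neg_pow]
  exact (eulerPoly n).smul_mem ⟨(-1) ^ i, gRing.pow_mem (gRing.neg_mem gRing.one_mem) i⟩
    (pow_mem_eulerPoly h)

theorem mul_mem_eulerPoly {g w : ℂ} {n : ℕ} (hg : g ∈ gRing) (hw : w ∈ eulerPoly n) :
    g * w ∈ eulerPoly n :=
  (eulerPoly n).smul_mem ⟨g, hg⟩ hw

theorem euler_mul_mem_eulerPoly {w : ℂ} {n : ℕ} (hw : w ∈ eulerPoly n) :
    (Real.eulerMascheroniConstant : ℂ) * w ∈ eulerPoly (n + 1) := by
  induction hw using Submodule.span_induction with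
  | mem x hx =>
    obtain ⟨i, hi, rfl⟩ := hx
    beta_reduce
    rw [← pow_succ']
    exact pow_mem_eulerPoly (Nat.succ_lt_succ hi)
  | zero => rw [mul_zero]; exact Submodule.zero_mem _
  | add x y _ _ hx hy => rw [mul_add]; exact Submodule.add_mem _ hx hy
  | smul a x _ hx => rw [mul_smul_comm]; exact Submodule.smul_mem _ _ hx

/-- All derivatives of `Γ` at `s` are `Γ(s)` times a polynomial in Euler's constant with leading
coefficient `±1`. -/
def GammaDerivExpansion (s : ℂ) : Prop :=
  ∀ n : ℕ, ∃ w ∈ eulerPoly n, iteratedDeriv n Complex.Gamma s =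
    Complex.Gamma s * ((-(Real.eulerMascheroniConstant : ℂ)) ^ n + w)

theorem GammaDerivExpansion.exists_mem {s : ℂ} {n : ℕ} (h : ∃ w ∈ eulerPoly n,
    iteratedDeriv n Complex.Gamma s =
      Complex.Gamma s * ((-(Real.eulerMascheroniConstant : ℂ)) ^ n + w)) :
    ∃ w ∈ eulerPoly (n + 1), iteratedDeriv n Complex.Gamma s = Complex.Gamma s * w := by
  obtain ⟨w, hw, h⟩ := h
  exact ⟨_, Submodule.add_mem _ (neg_pow_mem_eulerPoly n.lt_succ_self)
    (eulerPoly_mono n.le_succ hw), h⟩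

/-- Apply Leibniz' rule to Γ' = Γ ψ. The terms with i < n have ψ^(n-i)(s) in `gRing` and degree less
than n in γ; only the term i = n brings a new factor γ. -/
theorem gammaDerivExpansion_of_one_lt {s : ℚ} (hs : 1 < s) : GammaDerivExpansion s := by
  have hre : 1 < ((s : ℂ)).re := by
    rw [Complex.ratCast_re]; exact_mod_cast hs
  have hadm := admissible_of_pos (zero_lt_one.trans hs)
  intro n
  induction n using Nat.strong_induction_on with
  | _ n ih =>
    cases n with
    | zero => exact ⟨0, Submodule.zero_mem _, by simp⟩
    | succ n =>
      have h1 : iteratedDeriv (n + 1) Complex.Gamma s = ∑ i ∈ Finset.range (n + 1),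
          n.choose i * iteratedDeriv i Complex.Gamma s * iteratedDeriv (n - i) psi s := by
        rw [iteratedDeriv_succ', (deriv_Gamma_eventuallyEq hre).iteratedDeriv_eq,
          iteratedDeriv_fun_mul (Gamma_analyticAt (cast_ne_neg_of_admissible hadm)).contDiffAt
          (psi_analyticAt hre).contDiffAt]
      have h2 : ∃ w ∈ eulerPoly n, ∑ i ∈ Finset.range n,
          n.choose i * iteratedDeriv i Complex.Gamma s * iteratedDeriv (n - i) psi s =
          Complex.Gamma s * w := by
        have h3 : ∀ i ∈ Finset.range n, ∃ w ∈ eulerPoly n,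
            n.choose i * iteratedDeriv i Complex.Gamma s * iteratedDeriv (n - i) psi s =
            Complex.Gamma s * w := by
          intro i hi
          have hi := Finset.mem_range.1 hi
          obtain ⟨w, hw, hw'⟩ := GammaDerivExpansion.exists_mem (ih i (by omega))
          refine ⟨_, mul_mem_eulerPoly (gRing.mul_mem (natCast_mem gRing (n.choose i))
            (iteratedDeriv_psi_mem_gRing hs (m := n - i) (by omega)))
            (eulerPoly_mono (by omega) hw), ?_⟩
          rw [hw']
          ring
        choose! w hw hw' using h3
        refine ⟨_, Submodule.sum_mem _ hw, ?_⟩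
        rw [Finset.mul_sum]
        exact Finset.sum_congr rfl hw'
      obtain ⟨w, hw, hw'⟩ := h2
      obtain ⟨v, hv, hv'⟩ := ih n n.lt_succ_self
      have hg := psi_add_mem_gRing hs
      set g := psi s + (Real.eulerMascheroniConstant : ℂ) with hgdef
      have hpsi : psi s = g - (Real.eulerMascheroniConstant : ℂ) := by rw [hgdef]; ring
      -- With ψ(s) = g - γ, the last term is Γ(s) times (g - γ)((-γ)^n + v) = (-γ)^(n+1) + g((-γ)^n
      -- + v) - γv.
      refine ⟨w + (g * ((-(Real.eulerMascheroniConstant : ℂ)) ^ n + v) -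
        (Real.eulerMascheroniConstant : ℂ) * v), ?_, ?_⟩
      · refine Submodule.add_mem _ (eulerPoly_mono n.le_succ hw) (Submodule.sub_mem _
          (mul_mem_eulerPoly hg ?_) (euler_mul_mem_eulerPoly hv))
        exact Submodule.add_mem _ (neg_pow_mem_eulerPoly n.lt_succ_self)
          (eulerPoly_mono n.le_succ hv)
      · rw [h1, Finset.sum_range_succ, hw', hv', Nat.sub_self, iteratedDeriv_zero,
          Nat.choose_self, hpsi, pow_succ]
        push_cast
        ring

/-- Differentiate Γ(z+1) = zΓ(z) repeatedly and solve for the top derivative at s. Dividing by s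
cancels Γ(s+1) = sΓ(s), so the leading term is unchanged. -/
theorem GammaDerivExpansion.of_add_one {s : ℚ} (hs : s ∈ admissible)
    (h : GammaDerivExpansion ((s + 1 : ℚ) : ℂ)) : GammaDerivExpansion s := by
  have hs0 : (s : ℂ) ≠ 0 := by
    have := hs 0
    rw [Nat.cast_zero, neg_zero] at this
    exact_mod_cast this
  have hrec : ∀ n, iteratedDeriv n Complex.Gamma ((s + 1 : ℚ) : ℂ) =
      s * iteratedDeriv n Complex.Gamma s + n * iteratedDeriv (n - 1) Complex.Gamma s := by
    intro n
    rw [← iteratedDeriv_id_mul (Gamma_analyticAt (cast_ne_neg_of_admissible hs))]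
    have h1 := congrFun (iteratedDeriv_comp_add_const n Complex.Gamma (1 : ℂ)) (s : ℂ)
    push_cast
    rw [← h1]
    refine Filter.EventuallyEq.iteratedDeriv_eq n ?_
    filter_upwards [isOpen_ne.mem_nhds hs0] with z hz using Complex.Gamma_add_one z hz
  have hG : Complex.Gamma ((s + 1 : ℚ) : ℂ) = s * Complex.Gamma s := by
    push_cast
    exact Complex.Gamma_add_one _ hs0
  have hinv : ((s : ℂ))⁻¹ ∈ gRing := mem_gRing_of_isAlgebraic (by
    simpa using isAlgebraic_algebraMap (R := ℚ) (A := ℂ) s⁻¹)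
  intro n
  induction n with
  | zero => exact ⟨0, Submodule.zero_mem _, by simp⟩
  | succ n ih =>
    obtain ⟨w, hw, hw'⟩ := h (n + 1)
    obtain ⟨v, hv, hv'⟩ := GammaDerivExpansion.exists_mem ih
    refine ⟨w - ((n + 1 : ℕ) * (s : ℂ)⁻¹) * v, Submodule.sub_mem _ hw (mul_mem_eulerPoly
      (gRing.mul_mem (natCast_mem gRing _) hinv) hv), ?_⟩
    rw [hrec, hG, Nat.add_sub_cancel, hv'] at hw'
    apply mul_left_cancel₀ hs0
    rw [eq_sub_of_add_eq hw']
    field_simp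
    ring

theorem add_one_mem_admissible {s : ℚ} (hs : s ∈ admissible) : s + 1 ∈ admissible := fun m h =>
  hs (m + 1) (by push_cast; linarith)

theorem gammaDerivExpansion {s : ℚ} (hs : s ∈ admissible) : GammaDerivExpansion s := by
  obtain ⟨m, hm⟩ := exists_nat_gt (1 - s)
  induction m generalizing s with
  | zero => exact gammaDerivExpansion_of_one_lt (by push_cast at hm; linarith)
  | succ m ih =>
    exact (ih (add_one_mem_admissible hs) (by push_cast at hm; linarith)).of_add_one hs

end GSeries

/-! ### Equality of the two modules -/

namespace GSeries

theorem mem_adjoinEuler_of_mem_eulerPoly {n : ℕ} {w : ℂ} (hw : w ∈ eulerPoly n) :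
    w ∈ adjoinEuler gRing := by
  have h : eulerPoly n ≤ Subalgebra.toSubmodule (adjoinEuler gRing) := by
    refine Submodule.span_le.2 ?_
    rintro _ ⟨i, -, rfl⟩
    exact Subalgebra.pow_mem _ (Algebra.self_mem_adjoin_singleton _ _) i
  exact h hw

theorem Gamma_mul_mem_gammaModule {s : ℚ} (hs : s ∈ admissible) {w : ℂ}
    (hw : w ∈ adjoinEuler gRing) : w * Complex.Gamma s ∈ gammaModule gRing :=
  (gammaModule gRing).smul_mem ⟨w, hw⟩ (Submodule.subset_span ⟨s, hs, rfl⟩)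

theorem gammaDerivModule_subset : (gammaDerivModule gRing : Set ℂ) ⊆ gammaModule gRing := by
  have h : gammaDerivModule gRing ≤ (gammaModule gRing).restrictScalars gRing := by
    refine Submodule.span_le.2 ?_
    rintro _ ⟨n, s, hs, rfl⟩
    obtain ⟨w, hw, h⟩ := GammaDerivExpansion.exists_mem (gammaDerivExpansion hs n)
    rw [h, mul_comm]
    exact Gamma_mul_mem_gammaModule hs (mem_adjoinEuler_of_mem_eulerPoly hw)
  exact h

/-- Inversion of the triangular system: (-1)^n Γ(s)γ^n is Γ^(n)(s) minus terms with lower powers of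
γ, which are handled by induction. -/
theorem Gamma_mul_pow_mem {s : ℚ} (hs : s ∈ admissible) (n : ℕ) :
    Complex.Gamma s * (Real.eulerMascheroniConstant : ℂ) ^ n ∈ gammaDerivModule gRing := by
  induction n using Nat.strong_induction_on with
  | _ n ih =>
    obtain ⟨w, hw, h⟩ := gammaDerivExpansion hs n
    have h1 : Complex.Gamma s * w ∈ gammaDerivModule gRing := by
      clear h
      induction hw using Submodule.span_induction with
      | mem x hx =>
        obtain ⟨i, hi, rfl⟩ := hx
        exact ih i hi
      | zero => rw [mul_zero]; exact Submodule.zero_mem _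
      | add x y _ _ hx hy => rw [mul_add]; exact Submodule.add_mem _ hx hy
      | smul a x _ hx => rw [mul_smul_comm]; exact Submodule.smul_mem _ _ hx
    have h2 : iteratedDeriv n Complex.Gamma s ∈ gammaDerivModule gRing :=
      Submodule.subset_span ⟨n, s, hs, rfl⟩
    have h3 := (gammaDerivModule gRing).smul_mem ((-1) ^ n : gRing) (Submodule.sub_mem _ h2 h1)
    convert h3 using 1
    rw [h, Subring.smul_def, neg_pow]
    push_cast
    have h4 : ((-1 : ℂ) ^ n) * (-1) ^ n = 1 := by rw [← mul_pow]; simp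
    rw [smul_eq_mul]
    linear_combination (-(Complex.Gamma s * (Real.eulerMascheroniConstant : ℂ) ^ n)) * h4

theorem Gamma_mul_mem_gammaDerivModule {s : ℚ} (hs : s ∈ admissible) {n : ℕ} {w : ℂ}
    (hw : w ∈ eulerPoly n) : Complex.Gamma s * w ∈ gammaDerivModule gRing := by
  induction hw using Submodule.span_induction with
  | mem x hx =>
    obtain ⟨i, -, rfl⟩ := hx
    exact Gamma_mul_pow_mem hs i
  | zero => rw [mul_zero]; exact Submodule.zero_mem _
  | add x y _ _ hx hy => rw [mul_add]; exact Submodule.add_mem _ hx hy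
  | smul a x _ hx => rw [mul_smul_comm]; exact Submodule.smul_mem _ _ hx

/-- On a generator, the factor γ only raises the degree of the expansion by one. This makes the
module of derivatives stable under the scalars of `adjoinEuler gRing`. -/
theorem euler_mul_mem_gammaDerivModule {y : ℂ} (hy : y ∈ gammaDerivModule gRing) :
    (Real.eulerMascheroniConstant : ℂ) * y ∈ gammaDerivModule gRing := by
  induction hy using Submodule.span_induction with
  | mem x hx =>
    obtain ⟨n, s, hs, rfl⟩ := hx
    obtain ⟨w, hw, h⟩ := GammaDerivExpansion.exists_mem (gammaDerivExpansion hs n)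
    rw [h, mul_left_comm]
    exact Gamma_mul_mem_gammaDerivModule hs (euler_mul_mem_eulerPoly hw)
  | zero => rw [mul_zero]; exact Submodule.zero_mem _
  | add x y _ _ hx hy => rw [mul_add]; exact Submodule.add_mem _ hx hy
  | smul a x _ hx => rw [mul_smul_comm]; exact Submodule.smul_mem _ _ hx

theorem adjoinEuler_mul_mem_gammaDerivModule {x : ℂ} (hx : x ∈ adjoinEuler gRing) :
    ∀ y ∈ gammaDerivModule gRing, x * y ∈ gammaDerivModule gRing := by
  induction hx using Algebra.adjoin_induction with
  | mem x hx =>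
    rw [Set.mem_singleton_iff] at hx
    subst hx
    exact fun y hy => euler_mul_mem_gammaDerivModule hy
  | algebraMap r => exact fun y hy => (gammaDerivModule gRing).smul_mem r hy
  | add a b _ _ ha hb =>
    intro y hy
    rw [add_mul]
    exact Submodule.add_mem _ (ha y hy) (hb y hy)
  | mul a b _ _ ha hb =>
    intro y hy
    rw [mul_assoc]
    exact ha _ (hb y hy)

theorem gammaModule_subset : (gammaModule gRing : Set ℂ) ⊆ gammaDerivModule gRing := by
  intro x hx
  induction hx using Submodule.span_induction with
  | mem x hx =>
    obtain ⟨s, hs, rfl⟩ := hx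
    simpa using Gamma_mul_pow_mem hs 0
  | zero => exact Submodule.zero_mem _
  | add x y _ _ hx hy => exact Submodule.add_mem _ hx hy
  | smul a x _ hx => exact adjoinEuler_mul_mem_gammaDerivModule a.2 x hx

/-! ### Products of values of Γ -/

theorem exists_Gamma_eq_mul_of_pos {s : ℚ} (hs : s ∈ admissible) :
    ∃ t : ℚ, 0 < t ∧ ∃ g ∈ gRing, Complex.Gamma s = g * Complex.Gamma t := by
  obtain ⟨m, hm⟩ := exists_nat_gt (-s)
  induction m generalizing s with
  | zero => exact ⟨s, by push_cast at hm; linarith, 1, gRing.one_mem, by rw [one_mul]⟩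
  | succ m ih =>
    obtain ⟨t, ht, g, hg, h⟩ := ih (add_one_mem_admissible hs) (by push_cast at hm; linarith)
    have hs0 : (s : ℂ) ≠ 0 := by simpa using cast_ne_neg_of_admissible hs 0
    have hinv : ((s : ℂ))⁻¹ ∈ gRing := mem_gRing_of_isAlgebraic (by
      simpa using isAlgebraic_algebraMap (R := ℚ) (A := ℂ) s⁻¹)
    refine ⟨t, ht, _, gRing.mul_mem hinv hg, ?_⟩
    rw [mul_assoc, ← h]
    push_cast
    rw [Complex.Gamma_add_one _ hs0, inv_mul_cancel_left₀ hs0]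

theorem mem_adjoinEuler_of_mem_gRing {g : ℂ} (hg : g ∈ gRing) : g ∈ adjoinEuler gRing :=
  (adjoinEuler gRing).algebraMap_mem ⟨g, hg⟩

/-- Use Γ(s)Γ(t) = B(s,t)Γ(s+t) after shifting both arguments to positive ones, where the beta
integral converges and s + t is not a pole. -/
theorem Gamma_mul_Gamma_mem_gammaModule {s t : ℚ} (hs : s ∈ admissible) (ht : t ∈ admissible) :
    Complex.Gamma s * Complex.Gamma t ∈ gammaModule gRing := by
  obtain ⟨s', hs', g, hg, h⟩ := exists_Gamma_eq_mul_of_pos hs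
  obtain ⟨t', ht', k, hk, h'⟩ := exists_Gamma_eq_mul_of_pos ht
  have h1 := Complex.Gamma_mul_Gamma_eq_betaIntegral (s := s') (t := t') (by simpa using hs')
    (by simpa using ht')
  have h2 : Complex.Gamma s * Complex.Gamma t =
      g * k * Complex.betaIntegral s' t' * Complex.Gamma ((s' + t' : ℚ) : ℂ) := by
    rw [h, h']
    push_cast
    linear_combination g * k * h1
  rw [h2]
  exact Gamma_mul_mem_gammaModule (admissible_of_pos (add_pos hs' ht'))
    (mem_adjoinEuler_of_mem_gRing
      (gRing.mul_mem (gRing.mul_mem hg hk) (betaIntegral_mem_gRing hs' ht')))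

theorem mul_mem_gammaModule {x y : ℂ} (hx : x ∈ gammaModule gRing) (hy : y ∈ gammaModule gRing) :
    x * y ∈ gammaModule gRing := by
  have h : gammaModule gRing * gammaModule gRing ≤ gammaModule gRing := by
    conv_lhs => rw [gammaModule, Submodule.span_mul_span]
    refine Submodule.span_le.2 ?_
    rintro _ ⟨_, ⟨s, hs, rfl⟩, _, ⟨t, ht, rfl⟩, rfl⟩
    exact Gamma_mul_Gamma_mem_gammaModule hs ht
  exact h (Submodule.mul_mem_mul hx hy)

/-- The `gRing[γ]`-module generated by the values of `Γ`, as a ring. -/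
noncomputable def gammaRing : Subring ℂ where
  carrier := gammaModule gRing
  mul_mem' := mul_mem_gammaModule
  one_mem' := by
    have h := Gamma_mul_mem_gammaModule (admissible_of_pos one_pos) (adjoinEuler gRing).one_mem
    simpa using h
  add_mem' := Submodule.add_mem _
  zero_mem' := Submodule.zero_mem _
  neg_mem' := Submodule.neg_mem _

end GSeries

theorem mainTheorem9 :
    ∃ G : Subring ℂ, (G : Set ℂ) = GSeries.gValues ∧
      (GSeries.gammaDerivModule G : Set ℂ) = (GSeries.gammaModule G : Set ℂ) ∧
      ∃ S : Subring ℂ, (S : Set ℂ) = (GSeries.gammaDerivModule G : Set ℂ) := by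
  have h := GSeries.gammaDerivModule_subset.antisymm GSeries.gammaModule_subset
  exact ⟨GSeries.gRing, rfl, h, GSeries.gammaRing, h.symm⟩
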